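/- Let $n\ge 1$. Let $\Gamma_n=\mathbf s(\overline{\mathbb D}^n)\subset\mathbb C^n$ be the symmetrized polydisc, where $\mathbf s=(s_1,\dots,s_n)$ and $s_i$ is the elementary symmetric polynomial of degree $i$ in $n$ variables; its distinguished boundary $b\Gamma_n$ is the Shilov boundary of the algebra of functions that are continuous on $\Gamma_n$ and analytic in its interior. A tuple $(S_1,\dots,S_n)$ of commuting bounded operators on a complex Hilbert space is a $\Gamma_n$-unitary if all $S_i$ are normal and its joint spectrum is contained in $b\Gamma_n$. It is a $\Gamma_n$-isometry if it is the restriction of a $\Gamma_n$-unitary, acting on a possibly larger Hilbert space, to a joint invariant subspace, and a pure $\Gamma_n$-isometry if moreover $S_n$ is a pure isometry (an isometry without nonzero unitary part). For separable complex Hilbert spaces $\mathcal E,\mathcal F$, let $H^2(\mathcal E)$ be the Hardy space of $\mathcal E$-valued analytic functions on the unit disc $\mathbb D$, let $H^\infty\mathcal L(\mathcal E,\mathcal F)$ be the space of bounded analytic $\mathcal L(\mathcal E,\mathcal F)$-valued functions on $\mathbb D$, put $H^\infty\mathcal L(\mathcal E)=H^\infty\mathcal L(\mathcal E,\mathcal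 E)$, and let $M_\Theta:H^2(\mathcal E)\to H^2(\mathcal F)$ be multiplication by $\Theta\in H^\infty\mathcal L(\mathcal E,\mathcal F)$. The function $\Theta$ is inner if its strong radial boundary values are isometries almost everywhere on the unit circle. For $\Phi_1,\dots,\Phi_{n-1}\in H^\infty\mathcal L(\mathcal E)$ write $(M_{\mathbf\Phi},M_z)=(M_{\Phi_1},\dots,M_{\Phi_{n-1}},M_z)$ on $H^2(\mathcal E)$. **Theorem.** Let $\mathcal E_*$ be a separable complex Hilbert space, let $\mathcal M\neq\{0\}$ be a closed subspace of $H^2(\mathcal E_*)$, and let $\Phi_1,\dots,\Phi_{n-1}\in H^\infty\mathcal L(\mathcal E_*)$ be such that $(M_{\mathbf\Phi},M_z)$ is a pure $\Gamma_n$-isometry on $H^2(\mathcal E_*)$. 1. $\mathcal M$ is invariant under $M_{\Phi_1},\dots,M_{\Phi_{n-1}}$ and $M_z$ if and only if there exist a separable Hilbert space $\mathcal E$, an inner function $\Theta\in H^\infty\mathcal L(\mathcal E,\mathcal E_*)$ with $\mathcal M=M_\Theta H^2(\mathcal E)$, and functions $\Psi_1,\dots,\Psi_{n-1}\in H^\infty\mathcal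 L(\mathcal E)$ such that $(M_{\mathbf\Psi},M_z)$ is a pure $\Gamma_n$-isometry on $H^2(\mathcal E)$ and $\Phi_i\Theta=\Theta\Psi_i$ for $i=1,\dots,n-1$. 2. Whenever $\mathcal E$ is a separable Hilbert space and $\Theta\in H^\infty\mathcal L(\mathcal E,\mathcal E_*)$ is an inner function with $\mathcal M=M_\Theta H^2(\mathcal E)$ (a Beurling–Lax–Halmos representation of $\mathcal M$), $\mathcal M$ is invariant under $M_{\Phi_1},\dots,M_{\Phi_{n-1}}$ and $M_z$ if and only if there exist $\Psi_1,\dots,\Psi_{n-1}\in H^\infty\mathcal L(\mathcal E)$ such that $(M_{\mathbf\Psi},M_z)$ is a pure $\Gamma_n$-isometry on $H^2(\mathcal E)$ and $\Phi_i\Theta=\Theta\Psi_i$ for $i=1,\dots,n-1$. -/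

import Mathlib

universe u

set_option linter.unusedSectionVars false

noncomputable section

namespace GammaN

open Complex Filter Topology MeasureTheory

/-! ### The symmetrized polydisc and its distinguished boundary -/

/-- The symmetrization map `s : ℂⁿ → ℂⁿ`; the coordinate with index `i : Fin n` is the elementary
symmetric function of degree `i + 1`. -/
def symmetrization {n : ℕ} (z : Fin n → ℂ) : Fin n → ℂ :=
  fun i => ∑ t ∈ Finset.powersetCard (i.val + 1) (Finset.univ : Finset (Fin n)), ∏ j ∈ t, z j

/-- The symmetrized `n`-disc `Γ_n`, the image of the closed unit polydisc. -/
def symPolydisc (n : ℕ) : Set (Fin n → ℂ) :=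
  symmetrization '' {z | ∀ j, ‖z j‖ ≤ 1}

/-- A set `B ⊆ X` is a boundary for the algebra `A(X)` of functions continuous on `X` and analytic
on the interior of `X` if it is closed and every member of `A(X)` attains its maximum modulus
on `B`. -/
def IsClosedBoundary {n : ℕ} (X B : Set (Fin n → ℂ)) : Prop :=
  B ⊆ X ∧ IsClosed B ∧
    ∀ f : (Fin n → ℂ) → ℂ, ContinuousOn f X → DifferentiableOn ℂ f (interior X) →
      ∃ w ∈ B, ∀ z ∈ X, ‖f z‖ ≤ ‖f w‖

/-- The Shilov boundary of the algebra `A(X)` (the smallest closed boundary). -/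
def shilovBoundary {n : ℕ} (X : Set (Fin n → ℂ)) : Set (Fin n → ℂ) :=
  ⋂₀ {B | IsClosedBoundary X B}

/-- The distinguished boundary `bΓ_n` of the symmetrized `n`-disc. -/
def distinguishedBoundary (n : ℕ) : Set (Fin n → ℂ) :=
  shilovBoundary (symPolydisc n)

/-! ### Joint spectrum, `Γ_n`-unitaries and (pure) `Γ_n`-isometries -/

section Operators

variable {H : Type u} [NormedAddCommGroup H] [InnerProductSpace ℂ H] [CompleteSpace H]

/-- The unital C*-algebra `C*(S_1, …, S_n)` generated by a tuple of operators. -/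
def cstarGenerated {n : ℕ} (S : Fin n → (H →L[ℂ] H)) : StarSubalgebra ℂ (H →L[ℂ] H) :=
  (StarAlgebra.adjoin ℂ (Set.range S)).topologicalClosure

theorem mem_cstarGenerated {n : ℕ} (S : Fin n → (H →L[ℂ] H)) (i : Fin n) :
    S i ∈ cstarGenerated S :=
  StarSubalgebra.le_topologicalClosure _
    (StarAlgebra.subset_adjoin ℂ (Set.range S) (Set.mem_range_self i))

/-- The joint spectrum of a commuting tuple of normal operators: the set of all
`(χ(S_1), …, χ(S_n))`, where `χ` runs through the characters of the (commutative) C*-algebra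
`C*(S_1, …, S_n)`. -/
def jointSpectrum {n : ℕ} (S : Fin n → (H →L[ℂ] H)) : Set (Fin n → ℂ) :=
  {w | ∃ χ ∈ WeakDual.characterSpace ℂ (cstarGenerated S),
    ∀ i, χ (⟨S i, mem_cstarGenerated S i⟩ : cstarGenerated S) = w i}

/-- A `Γ_n`-unitary: commuting normal operators whose joint spectrum lies in the distinguished
boundary of `Γ_n`. -/
def IsGammaUnitary {n : ℕ} (S : Fin n → (H →L[ℂ] H)) : Prop :=
  (∀ i j, Commute (S i) (S j)) ∧ (∀ i, IsStarNormal (S i)) ∧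
    jointSpectrum S ⊆ distinguishedBoundary n

/-- A `Γ_n`-isometry: commuting operators that are the restriction of a `Γ_n`-unitary on a larger
Hilbert space to a joint invariant subspace. -/
def IsGammaIsometry {n : ℕ} (S : Fin n → (H →L[ℂ] H)) : Prop :=
  (∀ i j, Commute (S i) (S j)) ∧
    ∃ (K : Type u) (_ : NormedAddCommGroup K) (_ : InnerProductSpace ℂ K) (_ : CompleteSpace K)
      (J : H →ₗᵢ[ℂ] K) (T : Fin n → (K →L[ℂ] K)),
      IsGammaUnitary T ∧ ∀ i x, T i (J x) = J (S i x)

/-- A pure isometry: an isometry without unitary part, the space of the unitary part in the Wold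
decomposition of an isometry `V` being `⋂ₖ Vᵏ H`. -/
def IsPureIsometry (V : H →L[ℂ] H) : Prop :=
  (∀ x, ‖V x‖ = ‖x‖) ∧ ∀ x, (∀ k : ℕ, ∃ y, (V ^ k) y = x) → x = 0

/-- A pure `Γ_n`-isometry (`n = m + 1`): a `Γ_n`-isometry whose last entry is a pure isometry. -/
def IsPureGammaIsometry {m : ℕ} (S : Fin (m + 1) → (H →L[ℂ] H)) : Prop :=
  IsGammaIsometry S ∧ IsPureIsometry (S (Fin.last m))

end Operators

/-! ### The vector-valued Hardy space -/

section Hardy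

variable {E : Type u} [NormedAddCommGroup E] [InnerProductSpace ℂ E]
  {F : Type u} [NormedAddCommGroup F] [InnerProductSpace ℂ F]
  {G : Type u} [NormedAddCommGroup G] [InnerProductSpace ℂ G]

variable (E) in
/-- The Hardy space `H²(E)` of `E`-valued analytic functions on the unit disc with square summable
Taylor coefficients; a function is stored as the sequence of its Taylor coefficients at `0`, so
that the norm is the usual one, and `Hardy.eval` recovers the function. -/
abbrev Hardy : Type u := lp (fun _ : ℕ => E) 2

/-- The value at `z` of the analytic function `f ∈ H²(E)`. -/
def Hardy.eval (f : Hardy E) (z : ℂ) : E := ∑' n : ℕ, z ^ n • f n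

/-- The space `H^∞ L(E, F)` of bounded analytic operator-valued functions on the unit disc (the
values of `toFun` outside of the open unit disc are irrelevant). -/
structure HInfty (E F : Type u) [NormedAddCommGroup E] [InnerProductSpace ℂ E]
    [NormedAddCommGroup F] [InnerProductSpace ℂ F] where
  toFun : ℂ → (E →L[ℂ] F)
  differentiableOn : DifferentiableOn ℂ toFun (Metric.ball 0 1)
  bounded : ∃ C : ℝ, ∀ z ∈ Metric.ball (0 : ℂ) 1, ‖toFun z‖ ≤ C

instance : CoeFun (HInfty E F) (fun _ => ℂ → (E →L[ℂ] F)) := ⟨HInfty.toFun⟩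

/-- The function `z ↦ z I` in `H^∞ L(E)`. -/
def HInfty.coord : HInfty E E where
  toFun z := z • ContinuousLinearMap.id ℂ E
  differentiableOn := (differentiable_id.smul_const _).differentiableOn
  bounded := ⟨1, fun z hz => by
    rw [norm_smul]
    have h1 : ‖z‖ ≤ 1 := by simpa using (Metric.mem_ball.1 hz).le
    have h2 := ContinuousLinearMap.norm_id_le (𝕜 := ℂ) (E := E)
    nlinarith [norm_nonneg z, norm_nonneg (ContinuousLinearMap.id ℂ E)]⟩

/-- `Θ` is inner: for almost every point of the unit circle the strong radial limit of `Θ` at that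
point exists and is an isometry. -/
def HInfty.IsInner (Θ : HInfty E F) : Prop :=
  ∀ᵐ t : ℝ, ∃ V : E →ₗᵢ[ℂ] F, ∀ x : E,
    Tendsto (fun r : ℝ => Θ ((r : ℂ) * exp ((t : ℂ) * I)) x) (𝓝[<] 1) (𝓝 (V x))

/-! #### Elementary facts needed to define multiplication operators -/

theorem Hardy.summable_norm (f : Hardy E) {z : ℂ} (hz : ‖z‖ < 1) :
    Summable fun n : ℕ => ‖z ^ n • f n‖ := by
  refine Summable.of_nonneg_of_le (fun _ => norm_nonneg _) (fun n => ?_)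
    ((summable_geometric_of_lt_one (norm_nonneg z) hz).mul_right ‖f‖)
  rw [norm_smul, norm_pow]
  exact mul_le_mul_of_nonneg_left (lp.norm_apply_le_norm (by norm_num) f n) (by positivity)

theorem Hardy.norm_sq_hasSum (f : Hardy E) : HasSum (fun n => ‖f n‖ ^ 2) (‖f‖ ^ 2) := by
  have := lp.hasSum_norm (p := 2) (by norm_num) f
  simpa using this

theorem norm_expI_pow_smul (t : ℝ) (n : ℕ) (v : E) : ‖(exp ((t : ℂ) * I)) ^ n • v‖ = ‖v‖ := by
  rw [norm_smul, norm_pow, norm_exp_ofReal_mul_I, one_pow, one_mul]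

theorem integral_expI_pow (n m : ℕ) :
    ∫ t in (0 : ℝ)..(2 * Real.pi), exp (-((t : ℂ) * I)) ^ m * exp ((t : ℂ) * I) ^ n =
      if n = m then (2 * Real.pi : ℂ) else 0 := by
  have h : ∀ t : ℝ, exp (-((t : ℂ) * I)) ^ m * exp ((t : ℂ) * I) ^ n =
      exp ((((n : ℤ) - (m : ℤ) : ℤ) : ℂ) * I * t) := by
    intro t
    rw [← exp_nat_mul, ← exp_nat_mul, ← exp_add]
    congr 1
    push_cast
    ring
  simp_rw [h]
  split_ifs with hnm
  · simp [hnm]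
  · have hc : ((((n : ℤ) - (m : ℤ) : ℤ) : ℂ) * I) ≠ 0 := by
      refine mul_ne_zero ?_ I_ne_zero
      exact Int.cast_ne_zero.2 (sub_ne_zero.2 (by exact_mod_cast hnm))
    rw [integral_exp_mul_complex hc]
    have : exp ((((n : ℤ) - (m : ℤ) : ℤ) : ℂ) * I * ((2 * Real.pi : ℝ) : ℂ)) = 1 := by
      rw [← exp_int_mul_two_pi_mul_I ((n : ℤ) - (m : ℤ))]
      congr 1
      push_cast
      ring
    rw [this]
    simp

/-- Parseval's identity on the circle for absolutely convergent expansions. -/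
theorem parseval [CompleteSpace E] (v : ℕ → E) (hv : Summable fun n => ‖v n‖) :
    HasSum (fun n => ‖v n‖ ^ 2)
      ((2 * Real.pi)⁻¹ *
        ∫ t in (0 : ℝ)..(2 * Real.pi), ‖∑' n : ℕ, (exp ((t : ℂ) * I)) ^ n • v n‖ ^ 2) := by
  set G : ℝ → E := fun t => ∑' n : ℕ, (exp ((t : ℂ) * I)) ^ n • v n with hG
  have hcont : ∀ n, Continuous fun t : ℝ => (exp ((t : ℂ) * I)) ^ n • v n := fun n => by fun_prop
  have hGc : Continuous G :=
    continuous_tsum hcont hv (fun n t => (norm_expI_pow_smul t n (v n)).le)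
  have hGs : ∀ t : ℝ, HasSum (fun n => (exp ((t : ℂ) * I)) ^ n • v n) (G t) := fun t =>
    (Summable.of_norm (by simpa only [norm_expI_pow_smul] using hv)).hasSum
  have hGb : ∀ t, ‖G t‖ ≤ ∑' n, ‖v n‖ := fun t =>
    tsum_of_norm_bounded hv.hasSum (fun n => (norm_expI_pow_smul t n (v n)).le)
  have hpi : (2 * Real.pi : ℝ) ≠ 0 := by positivity
  have key : ∀ m : ℕ, ∫ t in (0 : ℝ)..(2 * Real.pi), exp (-((t : ℂ) * I)) ^ m • G t =
      (2 * Real.pi : ℂ) • v m := by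
    intro m
    have h1 : HasSum (fun n => ∫ t in (0 : ℝ)..(2 * Real.pi),
        exp (-((t : ℂ) * I)) ^ m • ((exp ((t : ℂ) * I)) ^ n • v n))
        (∫ t in (0 : ℝ)..(2 * Real.pi), exp (-((t : ℂ) * I)) ^ m • G t) := by
      refine intervalIntegral.hasSum_integral_of_dominated_convergence
        (fun n _ => ‖v n‖) (fun n => ?_) (fun n => ?_) ?_ ?_ ?_
      · exact Continuous.aestronglyMeasurable (by fun_prop)
      · refine ae_of_all _ fun t _ => ?_
        have : -((t : ℂ) * I) = ((-t : ℝ) : ℂ) * I := by push_cast; ring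
        rw [this, norm_expI_pow_smul, norm_expI_pow_smul]
      · exact ae_of_all _ fun t _ => hv
      · simp
      · exact ae_of_all _ fun t _ => (hGs t).const_smul _
    have h2 : ∀ n, (∫ t in (0 : ℝ)..(2 * Real.pi),
        exp (-((t : ℂ) * I)) ^ m • ((exp ((t : ℂ) * I)) ^ n • v n)) =
        if n = m then (2 * Real.pi : ℂ) • v m else 0 := by
      intro n
      simp_rw [smul_smul]
      rw [intervalIntegral.integral_smul_const, integral_expI_pow]
      split_ifs with h
      · rw [h]
      · simp
    simp_rw [h2] at h1
    exact h1.unique (hasSum_ite_eq m _)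
  have h3 : HasSum (fun m => ∫ t in (0 : ℝ)..(2 * Real.pi),
      (inner ℂ ((exp ((t : ℂ) * I)) ^ m • v m) (G t)).re)
      (∫ t in (0 : ℝ)..(2 * Real.pi), ‖G t‖ ^ 2) := by
    refine intervalIntegral.hasSum_integral_of_dominated_convergence
      (fun n _ => ‖v n‖ * ∑' n, ‖v n‖) (fun n => ?_) (fun n => ?_) ?_ ?_ ?_
    · exact Continuous.aestronglyMeasurable (by fun_prop)
    · refine ae_of_all _ fun t _ => ?_
      refine (Complex.abs_re_le_norm _).trans ((norm_inner_le_norm _ _).trans ?_)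
      rw [norm_expI_pow_smul]
      exact mul_le_mul_of_nonneg_left (hGb t) (norm_nonneg _)
    · exact ae_of_all _ fun t _ => hv.mul_right _
    · simp
    · refine ae_of_all _ fun t _ => ?_
      have h4 := ((hGs t).mapL (innerSL ℂ (G t)))
      have h5 : HasSum (fun n => (inner ℂ (G t) ((exp ((t : ℂ) * I)) ^ n • v n)).re)
          (inner ℂ (G t) (G t)).re := (Complex.hasSum_iff _ _).1 h4 |>.1
      have h6 : (inner ℂ (G t) (G t)).re = ‖G t‖ ^ 2 := inner_self_eq_norm_sq (𝕜 := ℂ) (G t)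
      rw [h6] at h5
      have h10 : (fun n => (inner ℂ ((exp ((t : ℂ) * I)) ^ n • v n) (G t)).re) =
          fun n => (inner ℂ (G t) ((exp ((t : ℂ) * I)) ^ n • v n)).re :=
        funext fun n => inner_re_symm (𝕜 := ℂ) _ _
      rw [h10]
      exact h5
  have h7 : ∀ m, (∫ t in (0 : ℝ)..(2 * Real.pi),
      (inner ℂ ((exp ((t : ℂ) * I)) ^ m • v m) (G t)).re) = (2 * Real.pi) * ‖v m‖ ^ 2 := by
    intro m
    have h8 : ∀ t : ℝ, (inner ℂ ((exp ((t : ℂ) * I)) ^ m • v m) (G t)).re =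
        (Complex.reCLM.comp ((innerSL ℂ (v m)).restrictScalars ℝ))
          (exp (-((t : ℂ) * I)) ^ m • G t) := by
      intro t
      simp [← Complex.exp_conj]
      ring
    simp_rw [h8]
    rw [ContinuousLinearMap.intervalIntegral_comp_comm, key]
    · have h6 : (inner ℂ (v m) (v m)) = ((‖v m‖ ^ 2 : ℝ) : ℂ) := by
        rw [inner_self_eq_norm_sq_to_K]; norm_cast
      have h9 : inner ℂ (v m) ((2 * Real.pi : ℂ) • v m) =
          (((2 * Real.pi) * ‖v m‖ ^ 2 : ℝ) : ℂ) := by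
        rw [inner_smul_right, h6]; push_cast; ring
      change (inner ℂ (v m) ((2 * Real.pi : ℂ) • v m)).re = _
      rw [h9, ofReal_re]
    · exact Continuous.intervalIntegrable (by fun_prop) _ _
  simp_rw [h7] at h3
  have := h3.mul_left (2 * Real.pi)⁻¹
  simpa [← mul_assoc, hpi] using this

theorem summable_norm_of_hasSum {c : ℕ → E} {g : ℂ → E}
    (hs : ∀ z ∈ Metric.ball (0 : ℂ) 1, HasSum (fun n => z ^ n • c n) (g z))
    {z : ℂ} (hz : ‖z‖ < 1) : Summable fun n => ‖z ^ n • c n‖ := by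
  obtain ⟨ρ, h1, h2⟩ := exists_between hz
  have hρ : 0 < ρ := (norm_nonneg z).trans_lt h1
  have hmem : (ρ : ℂ) ∈ Metric.ball (0 : ℂ) 1 := by simpa [abs_of_pos hρ] using h2
  have h0 := (hs _ hmem).summable.tendsto_atTop_zero.norm
  obtain ⟨B, hB⟩ := h0.bddAbove_range
  refine Summable.of_nonneg_of_le (fun _ => norm_nonneg _) (fun n => ?_)
    ((summable_geometric_of_lt_one (r := ‖z‖ / ρ) (by positivity)
      ((div_lt_one hρ).2 h1)).mul_right B)
  have h3 : ‖(ρ : ℂ) ^ n • c n‖ ≤ B := hB ⟨n, rfl⟩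
  rw [norm_smul, norm_pow] at h3 ⊢
  have h4 : ‖(ρ : ℂ)‖ = ρ := by simp [abs_of_pos hρ]
  rw [h4] at h3
  calc ‖z‖ ^ n * ‖c n‖ = (‖z‖ / ρ) ^ n * (ρ ^ n * ‖c n‖) := by
        rw [div_pow]; field_simp
    _ ≤ _ := by gcongr

theorem mem_ball_of_polar {r : ℝ} (h0 : 0 ≤ r) (h1 : r < 1) (t : ℝ) :
    (r : ℂ) * exp ((t : ℂ) * I) ∈ Metric.ball (0 : ℂ) 1 := by
  simpa [abs_of_nonneg h0, norm_exp_ofReal_mul_I] using h1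

/-- The mean square of a power series over the circle of radius `r < 1`. -/
theorem hasSum_circle [CompleteSpace E] {c : ℕ → E} {g : ℂ → E}
    (hs : ∀ z ∈ Metric.ball (0 : ℂ) 1, HasSum (fun n => z ^ n • c n) (g z))
    {r : ℝ} (h0 : 0 ≤ r) (h1 : r < 1) :
    HasSum (fun n => (r ^ n * ‖c n‖) ^ 2) ((2 * Real.pi)⁻¹ *
      ∫ t in (0 : ℝ)..(2 * Real.pi), ‖g ((r : ℂ) * exp ((t : ℂ) * I))‖ ^ 2) := by
  have hr : ‖(r : ℂ)‖ < 1 := by simpa [abs_of_nonneg h0] using h1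
  have h2 := parseval (fun n => (r : ℂ) ^ n • c n) (summable_norm_of_hasSum hs hr)
  have h3 : ∀ t : ℝ, ∑' n : ℕ, (exp ((t : ℂ) * I)) ^ n • (r : ℂ) ^ n • c n =
      g ((r : ℂ) * exp ((t : ℂ) * I)) := by
    intro t
    rw [← (hs _ (mem_ball_of_polar h0 h1 t)).tsum_eq]
    refine tsum_congr fun n => ?_
    rw [smul_smul, ← mul_pow, mul_comm]
  simp_rw [h3] at h2
  have h4 : ∀ n, ‖(r : ℂ) ^ n • c n‖ = r ^ n * ‖c n‖ := by
    intro n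
    rw [norm_smul, norm_pow]
    simp [abs_of_nonneg h0]
  simp_rw [h4] at h2
  exact h2

theorem Hardy.hasSum_eval [CompleteSpace E] (f : Hardy E) {z : ℂ}
    (hz : z ∈ Metric.ball (0 : ℂ) 1) : HasSum (fun n : ℕ => z ^ n • f n) (f.eval z) :=
  (f.summable_norm (by simpa using hz)).of_norm.hasSum

theorem Hardy.differentiableOn_eval [CompleteSpace E] (f : Hardy E) :
    DifferentiableOn ℂ f.eval (Metric.ball 0 1) := by
  intro z hz
  obtain ⟨ρ, h1, h2⟩ := exists_between (mem_ball_zero_iff.1 hz)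
  have hρ : 0 < ρ := (norm_nonneg z).trans_lt h1
  have hρ' : ‖(ρ : ℂ)‖ = ρ := by simp [abs_of_pos hρ]
  have h3 : DifferentiableOn ℂ f.eval (Metric.ball 0 ρ) := by
    refine differentiableOn_tsum_of_summable_norm
      (u := fun n => ‖(ρ : ℂ) ^ n • f n‖) (f.summable_norm (by rw [hρ']; exact h2))
      (fun n => ?_) Metric.isOpen_ball (fun n w hw => ?_)
    · exact ((differentiable_id.pow n).smul_const _).differentiableOn
    · rw [norm_smul, norm_smul, norm_pow, norm_pow, hρ']
      have : ‖w‖ ≤ ρ := (mem_ball_zero_iff.1 hw).le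
      gcongr
  exact (h3.differentiableAt
    (Metric.isOpen_ball.mem_nhds (mem_ball_zero_iff.2 h1))).differentiableWithinAt

theorem Hardy.eval_add [CompleteSpace E] (f g : Hardy E) {z : ℂ}
    (hz : z ∈ Metric.ball (0 : ℂ) 1) : (f + g).eval z = f.eval z + g.eval z := by
  refine ((f + g).hasSum_eval hz).unique ?_
  have := (f.hasSum_eval hz).add (g.hasSum_eval hz)
  simpa only [lp.coeFn_add, Pi.add_apply, smul_add] using this

theorem Hardy.eval_smul [CompleteSpace E] (a : ℂ) (f : Hardy E) {z : ℂ}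
    (hz : z ∈ Metric.ball (0 : ℂ) 1) : (a • f).eval z = a • f.eval z := by
  refine ((a • f).hasSum_eval hz).unique ?_
  have := (f.hasSum_eval hz).const_smul a
  simpa only [lp.coeFn_smul, Pi.smul_apply, smul_comm a] using this

/-- An element of the Hardy space is determined by its values on the unit disc. -/
theorem Hardy.ext_eval [CompleteSpace E] {f g : Hardy E}
    (h : ∀ z ∈ Metric.ball (0 : ℂ) 1, f.eval z = g.eval z) : f = g := by
  have hs : ∀ z ∈ Metric.ball (0 : ℂ) 1, HasSum (fun n : ℕ => z ^ n • (f n - g n)) (0 : E) := by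
    intro z hz
    have := (f.hasSum_eval hz).sub (g.hasSum_eval hz)
    rw [h z hz, sub_self] at this
    simpa only [smul_sub] using this
  have h2 := hasSum_circle (g := fun _ => (0 : E)) hs (r := 1 / 2) (by norm_num) (by norm_num)
  simp only [norm_zero, ne_eq, OfNat.ofNat_ne_zero, not_false_eq_true, zero_pow,
    intervalIntegral.integral_zero, mul_zero] at h2
  ext n
  have h3 := (hasSum_zero_iff_of_nonneg (fun n => by positivity)).1 h2
  have h4 := congrFun h3 n
  simp only [Pi.zero_apply, ne_eq, OfNat.ofNat_ne_zero, not_false_eq_true, pow_eq_zero_iff,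
    mul_eq_zero, norm_eq_zero] at h4
  rcases h4 with h4 | h4
  · norm_num at h4
  · exact sub_eq_zero.1 h4

/-- The Taylor coefficients at `0` of `z ↦ Θ(z) f(z)`. -/
def mulCoeff (Θ : HInfty E F) (f : Hardy E) (n : ℕ) : F :=
  ((n.factorial : ℂ))⁻¹ • iteratedDeriv n (fun z => Θ z (f.eval z)) 0

theorem differentiableOn_mul [CompleteSpace E] (Θ : HInfty E F) (f : Hardy E) :
    DifferentiableOn ℂ (fun z => Θ z (f.eval z)) (Metric.ball 0 1) :=
  Θ.differentiableOn.clm_apply f.differentiableOn_eval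

theorem hasSum_mulCoeff [CompleteSpace E] [CompleteSpace F] (Θ : HInfty E F) (f : Hardy E)
    (z : ℂ) (hz : z ∈ Metric.ball (0 : ℂ) 1) :
    HasSum (fun n => z ^ n • mulCoeff Θ f n) (Θ z (f.eval z)) := by
  have h := Complex.hasSum_taylorSeries_on_ball (differentiableOn_mul Θ f) hz
  simp only [sub_zero] at h
  have h2 : (fun n => z ^ n • mulCoeff Θ f n) = fun n : ℕ => ((n.factorial : ℂ))⁻¹ •
      z ^ n • iteratedDeriv n (fun z => Θ z (f.eval z)) 0 :=
    funext fun n => smul_comm _ _ _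
  rw [h2]
  exact h

theorem mulCoeff_bound [CompleteSpace E] [CompleteSpace F] (Θ : HInfty E F) {C : ℝ}
    (hC : ∀ z ∈ Metric.ball (0 : ℂ) 1, ‖Θ z‖ ≤ C) (f : Hardy E) (s : Finset ℕ) :
    ∑ n ∈ s, ‖mulCoeff Θ f n‖ ^ 2 ≤ (C * ‖f‖) ^ 2 := by
  have key : ∀ r : ℝ, 0 ≤ r → r < 1 →
      ∑ n ∈ s, (r ^ n * ‖mulCoeff Θ f n‖) ^ 2 ≤ (C * ‖f‖) ^ 2 := by
    intro r h0 h1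
    have hcirc : Continuous fun t : ℝ => (r : ℂ) * exp ((t : ℂ) * I) := by fun_prop
    have hf := hasSum_circle (fun z hz => f.hasSum_eval hz) h0 h1
    have hg := hasSum_circle (hasSum_mulCoeff Θ f) h0 h1
    refine (sum_le_hasSum s (fun n _ => by positivity) hg).trans ?_
    have hfc : Continuous fun t : ℝ => f.eval ((r : ℂ) * exp ((t : ℂ) * I)) :=
      f.differentiableOn_eval.continuousOn.comp_continuous hcirc (mem_ball_of_polar h0 h1)
    have hgc : Continuous fun t : ℝ => Θ ((r : ℂ) * exp ((t : ℂ) * I))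
        (f.eval ((r : ℂ) * exp ((t : ℂ) * I))) :=
      (differentiableOn_mul Θ f).continuousOn.comp_continuous hcirc (mem_ball_of_polar h0 h1)
    have hle : (2 * Real.pi)⁻¹ * (∫ t in (0 : ℝ)..(2 * Real.pi),
        ‖Θ ((r : ℂ) * exp ((t : ℂ) * I)) (f.eval ((r : ℂ) * exp ((t : ℂ) * I)))‖ ^ 2) ≤
        (2 * Real.pi)⁻¹ * (C ^ 2 * ∫ t in (0 : ℝ)..(2 * Real.pi),
          ‖f.eval ((r : ℂ) * exp ((t : ℂ) * I))‖ ^ 2) := by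
      refine mul_le_mul_of_nonneg_left ?_ (inv_nonneg.2 Real.two_pi_pos.le)
      rw [← intervalIntegral.integral_const_mul]
      refine intervalIntegral.integral_mono_on (μ := volume) Real.two_pi_pos.le
        ((hgc.norm.pow 2).intervalIntegrable _ _)
        ((continuous_const.mul (hfc.norm.pow 2)).intervalIntegrable _ _) (fun t _ => ?_)
      rw [← mul_pow]
      exact pow_le_pow_left₀ (norm_nonneg _)
        (ContinuousLinearMap.le_of_opNorm_le _ (hC _ (mem_ball_of_polar h0 h1 t)) _) 2
    refine hle.trans ?_
    rw [mul_left_comm, mul_pow]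
    refine mul_le_mul_of_nonneg_left ?_ (sq_nonneg C)
    refine hasSum_le (fun n => ?_) hf f.norm_sq_hasSum
    refine pow_le_pow_left₀ (by positivity) ?_ 2
    exact mul_le_of_le_one_left (norm_nonneg _) (pow_le_one₀ h0 h1.le)
  have hlim : Tendsto (fun r : ℝ => ∑ n ∈ s, (r ^ n * ‖mulCoeff Θ f n‖) ^ 2) (𝓝[<] 1)
      (𝓝 (∑ n ∈ s, ‖mulCoeff Θ f n‖ ^ 2)) := by
    have hc : Continuous fun r : ℝ => ∑ n ∈ s, (r ^ n * ‖mulCoeff Θ f n‖) ^ 2 := by fun_prop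
    have := (hc.tendsto 1).mono_left (nhdsWithin_le_nhds (s := Set.Iio 1))
    simpa using this
  refine le_of_tendsto hlim ?_
  filter_upwards [Ioo_mem_nhdsLT (zero_lt_one' ℝ)] with r hr
  exact key r hr.1.le hr.2

/-- The product `Θ f`, as an element of the Hardy space. -/
def HInfty.mulVec [CompleteSpace E] [CompleteSpace F] (Θ : HInfty E F) (f : Hardy E) : Hardy F :=
  ⟨mulCoeff Θ f, by
    obtain ⟨C, hC⟩ := Θ.bounded
    refine memℓp_gen (summable_of_sum_le (c := (C * ‖f‖) ^ 2) (fun n => by positivity)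
      fun s => ?_)
    simpa using mulCoeff_bound Θ hC f s⟩

theorem HInfty.eval_mulVec [CompleteSpace E] [CompleteSpace F] (Θ : HInfty E F) (f : Hardy E)
    {z : ℂ} (hz : z ∈ Metric.ball (0 : ℂ) 1) : (Θ.mulVec f).eval z = Θ z (f.eval z) :=
  (hasSum_mulCoeff Θ f z hz).tsum_eq

theorem HInfty.norm_mulVec_le [CompleteSpace E] [CompleteSpace F] (Θ : HInfty E F) {C : ℝ}
    (hC : ∀ z ∈ Metric.ball (0 : ℂ) 1, ‖Θ z‖ ≤ C) (f : Hardy E) :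
    ‖Θ.mulVec f‖ ≤ C * ‖f‖ := by
  have h0 : 0 ≤ C := (norm_nonneg _).trans (hC 0 (by simp))
  refine le_of_sq_le_sq ?_ (by positivity)
  rw [← (Θ.mulVec f).norm_sq_hasSum.tsum_eq]
  exact (Θ.mulVec f).norm_sq_hasSum.summable.tsum_le_of_sum_le (mulCoeff_bound Θ hC f)

/-- The multiplication operator `M_Θ : H²(E) → H²(F)`, `(M_Θ f)(z) = Θ(z) f(z)`. -/
def mulOp [CompleteSpace E] [CompleteSpace F] (Θ : HInfty E F) : Hardy E →L[ℂ] Hardy F :=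
  LinearMap.mkContinuousOfExistsBound
    { toFun := Θ.mulVec
      map_add' := fun f g => Hardy.ext_eval fun z hz => by
        rw [Hardy.eval_add _ _ hz, Θ.eval_mulVec _ hz, Θ.eval_mulVec _ hz, Θ.eval_mulVec _ hz,
          Hardy.eval_add _ _ hz, map_add]
      map_smul' := fun a f => Hardy.ext_eval fun z hz => by
        rw [RingHom.id_apply, Hardy.eval_smul _ _ hz, Θ.eval_mulVec _ hz, Θ.eval_mulVec _ hz,
          Hardy.eval_smul _ _ hz, map_smul] }
    (Θ.bounded.imp fun _ hC => Θ.norm_mulVec_le hC)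

theorem eval_mulOp [CompleteSpace E] [CompleteSpace F] (Θ : HInfty E F) (f : Hardy E)
    {z : ℂ} (hz : z ∈ Metric.ball (0 : ℂ) 1) : (mulOp Θ f).eval z = Θ z (f.eval z) :=
  Θ.eval_mulVec f hz

/-- The tuple `(M_Φ, M_z) = (M_{Φ_1}, …, M_{Φ_{n-1}}, M_z)` on `H²(E)`, where `n = m + 1`. -/
def mulTuple [CompleteSpace E] {m : ℕ} (Φ : Fin m → HInfty E E) :
    Fin (m + 1) → (Hardy E →L[ℂ] Hardy E) :=
  Fin.snoc (fun i => mulOp (Φ i)) (mulOp HInfty.coord)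

/-- A subspace is `(M_Φ, M_z)`-invariant if it is invariant under every operator of the tuple. -/
def IsJointlyInvariant [CompleteSpace E] {m : ℕ} (Φ : Fin m → HInfty E E)
    (M : Submodule ℂ (Hardy E)) : Prop :=
  ∀ i, ∀ f ∈ M, mulTuple Φ i f ∈ M

end Hardy

end GammaN

/-! Write `W` for multiplication by an inner `Θ`; it is an isometry of H²(E) onto `M` that
intertwines the two shifts. If `M` is invariant under `M_{Φ_i}`, then `W* M_{Φ_i} W` is the
restriction of `M_{Φ_i}` to `M`, transported to H²(E). It commutes with the shift, so it is
multiplication by some bounded analytic `Ψ_i`, and `Φ_i Θ = Θ Ψ_i`. A Γ_n-unitary extending the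
Φ-tuple through an isometry `J` extends the Ψ-tuple through `J ∘ W`, and the last entry is again a
shift, hence pure. So the geometry of the distinguished boundary plays no role: only heredity under
restriction matters. Conversely, `Φ_i Θ = Θ Ψ_i` maps the range of `W` into itself. These are
`exists_isPureGammaIsometry` and `isJointlyInvariant_range`.

Three classical facts carry the argument. Operators intertwining shifts are multiplications by
bounded analytic functions (`exists_mulOp_eq`). The Beurling–Lax–Halmos theorem
(`exists_inner_range_eq`) comes from the Wold decomposition of the shift on `M`: the wandering
subspace serves as `E`. Finally, `Θ` is inner if and only if `W` is isometric; the two directions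
used are `isInner_of_isometry` and `norm_mulOp_of_isInner`.

Since innerness is stated through strong radial limits, the last fact needs Fatou's theorem for
Hilbert-space valued functions (`Hardy.ae_exists_radial_limit`). The primitive of `f ∈ H²` is
continuous on the closed disc and absolutely continuous on the circle with an L² derivative.
Lebesgue differentiation gives a tangential derivative almost everywhere, and `tendsto_deriv_radial`
converts it into a radial limit of `f`. -/

namespace GammaN

open scoped ComplexConjugate
open Complex Filter Topology MeasureTheory

/-! ### Taylor coefficients, the shift and the reproducing kernel of the Hardy space. -/

section Single

variable {E : Type u} [NormedAddCommGroup E] [InnerProductSpace ℂ E]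
  {F : Type u} [NormedAddCommGroup F] [InnerProductSpace ℂ F]

/-- Bounded operators on the Hardy space are determined by their values on monomials. -/
theorem Hardy.clm_ext {G : Type*} [NormedAddCommGroup G] [NormedSpace ℂ G]
    {S T : Hardy E →L[ℂ] G}
    (h : ∀ n x, S (lp.single 2 n x) = T (lp.single 2 n x)) : S = T := by
  ext f
  have hf : HasSum (fun n => lp.single 2 n (f n)) f := lp.hasSum_single (by simp) f
  have h1 := hf.mapL S
  simp only [h] at h1
  exact h1.unique (hf.mapL T)

theorem Hardy.eval_single (n : ℕ) (x : E) (z : ℂ) :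
    Hardy.eval (lp.single 2 n x : Hardy E) z = z ^ n • x := by
  rw [Hardy.eval, tsum_eq_single n]
  · rw [lp.single_apply_self]
  · intro k hk
    rw [lp.single_apply_ne _ _ _ hk, smul_zero]

variable [CompleteSpace E] [CompleteSpace F]

/-- The difference of the two expansions represents 0, and the mean square over the circle of radius
1/2 is then a vanishing sum of nonnegative terms. This is what allows operators defined through
values to be computed on coefficients. -/
theorem eq_of_hasSum_pow_smul {c d : ℕ → E} {g : ℂ → E}
    (hc : ∀ z ∈ Metric.ball (0 : ℂ) 1, HasSum (fun n => z ^ n • c n) (g z))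
    (hd : ∀ z ∈ Metric.ball (0 : ℂ) 1, HasSum (fun n => z ^ n • d n) (g z)) : c = d := by
  have hs : ∀ z ∈ Metric.ball (0 : ℂ) 1, HasSum (fun n : ℕ => z ^ n • (c n - d n)) (0 : E) := by
    intro z hz
    simpa only [smul_sub, sub_self] using (hc z hz).sub (hd z hz)
  have h2 := hasSum_circle (g := fun _ => (0 : E)) hs (r := 1 / 2) (by norm_num) (by norm_num)
  simp only [norm_zero, ne_eq, OfNat.ofNat_ne_zero, not_false_eq_true, zero_pow,
    intervalIntegral.integral_zero, mul_zero] at h2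
  ext n
  have h4 := congrFun ((hasSum_zero_iff_of_nonneg (fun n => by positivity)).1 h2) n
  simp only [Pi.zero_apply, ne_eq, OfNat.ofNat_ne_zero, not_false_eq_true, pow_eq_zero_iff,
    mul_eq_zero, norm_eq_zero] at h4
  rcases h4 with h4 | h4
  · norm_num at h4
  · exact sub_eq_zero.1 h4

variable (E) in
/-- The unilateral shift `M_z` on the Hardy space. -/
abbrev shift : Hardy E →L[ℂ] Hardy E := mulOp HInfty.coord

theorem eval_shift (f : Hardy E) {z : ℂ} (hz : z ∈ Metric.ball (0 : ℂ) 1) :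
    (shift E f).eval z = z • f.eval z := by
  rw [eval_mulOp _ _ hz]
  rfl

theorem shift_single (n : ℕ) (x : E) :
    shift E (lp.single 2 n x) = lp.single 2 (n + 1) x := by
  refine Hardy.ext_eval fun z hz => ?_
  rw [eval_shift _ hz, Hardy.eval_single, Hardy.eval_single, smul_smul, pow_succ']

theorem shift_pow_single (n k : ℕ) (x : E) :
    (shift E ^ n) (lp.single 2 k x) = lp.single 2 (k + n) x := by
  induction n with
  | zero => simp
  | succ n ih => rw [pow_succ', mul_apply_eq_comp, ih, shift_single, add_assoc]

theorem coe_shift (f : Hardy E) :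
    (shift E f : ℕ → E) = fun n => Nat.casesOn n 0 fun k => f k := by
  refine eq_of_hasSum_pow_smul (fun z hz => (shift E f).hasSum_eval hz) fun z hz => ?_
  rw [eval_shift f hz, ← hasSum_nat_add_iff' 1]
  simpa [smul_smul, pow_succ'] using (f.hasSum_eval hz).const_smul z

theorem shift_apply_zero (f : Hardy E) : shift E f 0 = 0 := congrFun (coe_shift f) 0

theorem shift_apply_succ (f : Hardy E) (n : ℕ) : shift E f (n + 1) = f n :=
  congrFun (coe_shift f) (n + 1)

theorem norm_shift (f : Hardy E) : ‖shift E f‖ = ‖f‖ := by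
  have h := (shift E f).norm_sq_hasSum
  rw [← hasSum_nat_add_iff' 1] at h
  simp only [shift_apply_succ, Finset.sum_range_one, shift_apply_zero] at h
  have h2 := h.unique f.norm_sq_hasSum
  simp only [norm_zero, ne_eq, OfNat.ofNat_ne_zero, not_false_eq_true, zero_pow, sub_zero] at h2
  exact (pow_left_inj₀ (norm_nonneg _) (norm_nonneg _) two_ne_zero).1 h2

theorem shift_pow_apply_of_lt (f : Hardy E) {n k : ℕ} (h : k < n) : (shift E ^ n) f k = 0 := by
  induction n generalizing k with
  | zero => omega
  | succ n ih =>
    rw [pow_succ', mul_apply_eq_comp]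
    cases k with
    | zero => exact shift_apply_zero _
    | succ k => rw [shift_apply_succ]; exact ih (by omega)

/-- An element of the range of the (k+1)-st power has zero coefficients up to index k. -/
theorem isPureIsometry_shift : IsPureIsometry (shift E) := by
  refine ⟨norm_shift, fun x hx => ?_⟩
  ext k
  obtain ⟨y, rfl⟩ := hx (k + 1)
  exact shift_pow_apply_of_lt y (Nat.lt_succ_self k)

/-- Needed because the coefficient space in the Beurling–Lax–Halmos theorem is a subspace of the
Hardy space and must be separable. -/
instance [TopologicalSpace.SeparableSpace E] : TopologicalSpace.SeparableSpace (Hardy E) := by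
  have h1 : TopologicalSpace.IsSeparable
      (⋃ n : ℕ, Set.range fun x : E => (lp.single 2 n x : Hardy E)) := by
    refine .iUnion fun n => ?_
    exact TopologicalSpace.isSeparable_range
      (lp.isometry_single (E := fun _ : ℕ => E) (p := 2) n).continuous
  have h2 := (h1.span (R := ℂ)).closure
  refine TopologicalSpace.isSeparable_univ_iff.1 (h2.mono fun f _ => ?_)
  have hf : HasSum (fun n => lp.single 2 n (f n)) f := lp.hasSum_single (by simp) f
  refine mem_closure_of_tendsto hf (Eventually.of_forall fun s => ?_)
  exact Submodule.sum_mem _ fun n _ => Submodule.subset_span (Set.mem_iUnion.2 ⟨n, f n, rfl⟩)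

/-- The element `w ↦ x / (1 - c w)` of the Hardy space. -/
theorem exists_geometric (x : E) {c : ℂ} (hc : ‖c‖ < 1) :
    ∃ k : Hardy E, (∀ n, k n = c ^ n • x) ∧ (1 - ‖c‖ ^ 2) * ‖k‖ ^ 2 = ‖x‖ ^ 2 := by
  have h1 : ‖c‖ ^ 2 < 1 := pow_lt_one₀ (norm_nonneg _) hc two_ne_zero
  have hs : HasSum (fun n : ℕ => ‖c ^ n • x‖ ^ 2) ((1 - ‖c‖ ^ 2)⁻¹ * ‖x‖ ^ 2) := by
    have := (hasSum_geometric_of_lt_one (sq_nonneg ‖c‖) h1).mul_right (‖x‖ ^ 2)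
    convert! this using 2 with n
    rw [norm_smul, norm_pow, mul_pow, ← pow_mul, ← pow_mul, mul_comm n]
  have hm : Memℓp (fun n : ℕ => c ^ n • x) 2 := memℓp_gen (by simpa using hs.summable)
  refine ⟨⟨_, hm⟩, fun n => rfl, ?_⟩
  have h3 := (Hardy.norm_sq_hasSum (⟨_, hm⟩ : Hardy E)).unique hs
  rw [h3, mul_inv_cancel_left₀ (by linarith)]

/-- The reproducing kernel estimate. -/
theorem Hardy.norm_sq_eval_le (f : Hardy E) {z : ℂ} (hz : z ∈ Metric.ball (0 : ℂ) 1) :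
    (1 - ‖z‖ ^ 2) * ‖f.eval z‖ ^ 2 ≤ ‖f‖ ^ 2 := by
  have hz' : ‖conj z‖ < 1 := by simpa using hz
  -- The Szegő kernel at `z` in the direction `f(z)`: pairing it with `f` yields `‖f(z)‖²`, and
  -- Cauchy–Schwarz gives the estimate.
  obtain ⟨k, hk, hkn⟩ := exists_geometric (f.eval z) hz'
  rw [RCLike.norm_conj] at hkn
  have h1 : inner ℂ k f = ((‖f.eval z‖ ^ 2 : ℝ) : ℂ) := by
    have h2 := (f.hasSum_eval hz).mapL (innerSL ℂ (f.eval z))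
    have h3 := lp.hasSum_inner (𝕜 := ℂ) k f
    simp only [hk, inner_smul_left, map_pow, RCLike.conj_conj] at h3
    simp only [innerSL_apply_apply, inner_smul_right] at h2
    rw [h3.unique h2, inner_self_eq_norm_sq_to_K]
    norm_cast
  have h4 : ‖f.eval z‖ ^ 2 ≤ ‖k‖ * ‖f‖ := by
    have := norm_inner_le_norm (𝕜 := ℂ) k f
    rwa [h1, norm_real, Real.norm_of_nonneg (sq_nonneg _)] at this
  have h5 : 0 < 1 - ‖z‖ ^ 2 := by
    have : ‖z‖ < 1 := by simpa using hz
    nlinarith [norm_nonneg z]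
  rcases (sq_nonneg ‖f.eval z‖).eq_or_lt with h0 | h0
  · rw [← h0, mul_zero]
    positivity
  · have h6 : (‖f.eval z‖ ^ 2) ^ 2 ≤ (‖k‖ * ‖f‖) ^ 2 := pow_le_pow_left₀ h0.le h4 2
    refine le_of_mul_le_mul_right ?_ h0
    calc (1 - ‖z‖ ^ 2) * ‖f.eval z‖ ^ 2 * ‖f.eval z‖ ^ 2
        = (1 - ‖z‖ ^ 2) * (‖f.eval z‖ ^ 2) ^ 2 := by ring
      _ ≤ (1 - ‖z‖ ^ 2) * (‖k‖ * ‖f‖) ^ 2 := mul_le_mul_of_nonneg_left h6 h5.le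
      _ = ‖f‖ ^ 2 * ((1 - ‖z‖ ^ 2) * ‖k‖ ^ 2) := by ring
      _ = ‖f‖ ^ 2 * ‖f.eval z‖ ^ 2 := by rw [hkn]


end Single

/-! ### Operators that intertwine shifts are multiplication operators. -/

section Intertwining

variable {E : Type u} [NormedAddCommGroup E] [InnerProductSpace ℂ E] [CompleteSpace E]
  {F : Type u} [NormedAddCommGroup F] [InnerProductSpace ℂ F] [CompleteSpace F]

theorem shift_comm_mulOp (Θ : HInfty E F) (f : Hardy E) :
    mulOp Θ (shift E f) = shift F (mulOp Θ f) := by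
  refine Hardy.ext_eval fun z hz => ?_
  rw [eval_mulOp _ _ hz, eval_shift _ hz, eval_shift _ hz, eval_mulOp _ _ hz, map_smul]

variable (E) in
/-- Evaluation at a point of the disc, as a bounded operator. -/
def Hardy.evalL (z : ℂ) (hz : z ∈ Metric.ball (0 : ℂ) 1) : Hardy E →L[ℂ] E :=
  LinearMap.mkContinuousOfExistsBound
    { toFun := fun f => f.eval z
      map_add' := fun f g => Hardy.eval_add f g hz
      map_smul' := fun a f => Hardy.eval_smul a f hz }
    ⟨√(1 - ‖z‖ ^ 2)⁻¹, fun f => by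
      have h5 : 0 < 1 - ‖z‖ ^ 2 := by
        have : ‖z‖ < 1 := by simpa using hz
        nlinarith [norm_nonneg z]
      refine le_of_sq_le_sq ?_ (by positivity)
      rw [mul_pow, Real.sq_sqrt (by positivity), inv_mul_eq_div, le_div_iff₀' h5]
      exact f.norm_sq_eval_le hz⟩

theorem Hardy.evalL_apply (z : ℂ) (hz : z ∈ Metric.ball (0 : ℂ) 1) (f : Hardy E) :
    Hardy.evalL E z hz f = f.eval z := rfl

theorem commute_pow_of_commute_shift (T : Hardy E →L[ℂ] Hardy F)
    (hT : ∀ f, T (shift E f) = shift F (T f)) (n : ℕ) (f : Hardy E) :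
    T ((shift E ^ n) f) = (shift F ^ n) (T f) := by
  induction n with
  | zero => simp
  | succ n ih => rw [pow_succ', pow_succ', mul_apply_eq_comp, mul_apply_eq_comp, hT, ih]

theorem eval_shift_pow (n : ℕ) (f : Hardy E) {z : ℂ} (hz : z ∈ Metric.ball (0 : ℂ) 1) :
    ((shift E ^ n) f).eval z = z ^ n • f.eval z := by
  induction n with
  | zero => simp
  | succ n ih => rw [pow_succ', mul_apply_eq_comp, eval_shift _ hz, ih, smul_smul, pow_succ']

/-- The Taylor coefficients of the symbol of an operator that intertwines the shifts. -/
def symbolCoeff (T : Hardy E →L[ℂ] Hardy F) (n : ℕ) : E →L[ℂ] F :=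
  (lp.evalCLM ℂ (fun _ : ℕ => F) 2 n).comp
    (T.comp (lp.singleContinuousLinearMap ℂ (fun _ : ℕ => E) 2 0))

theorem symbolCoeff_apply (T : Hardy E →L[ℂ] Hardy F) (n : ℕ) (x : E) :
    symbolCoeff T n x = T (lp.single 2 0 x) n := rfl

theorem norm_symbolCoeff_le (T : Hardy E →L[ℂ] Hardy F) (n : ℕ) : ‖symbolCoeff T n‖ ≤ ‖T‖ := by
  refine ContinuousLinearMap.opNorm_le_bound _ T.opNorm_nonneg fun x => ?_
  rw [symbolCoeff_apply]
  refine (lp.norm_apply_le_norm (by norm_num) _ n).trans ?_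
  simpa [lp.norm_single] using T.le_opNorm (lp.single 2 0 x)

/-- The symbol of an operator that intertwines the shifts. -/
def symbol (T : Hardy E →L[ℂ] Hardy F) (z : ℂ) : E →L[ℂ] F :=
  ∑' n : ℕ, z ^ n • symbolCoeff T n

theorem summable_symbol (T : Hardy E →L[ℂ] Hardy F) {z : ℂ} (hz : ‖z‖ < 1) :
    Summable fun n : ℕ => ‖z ^ n • symbolCoeff T n‖ := by
  refine Summable.of_nonneg_of_le (fun _ => norm_nonneg _) (fun n => ?_)
    ((summable_geometric_of_lt_one (norm_nonneg z) hz).mul_right ‖T‖)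
  rw [norm_smul, norm_pow]
  exact mul_le_mul_of_nonneg_left (norm_symbolCoeff_le T n) (by positivity)

theorem symbol_apply (T : Hardy E →L[ℂ] Hardy F) {z : ℂ} (hz : z ∈ Metric.ball (0 : ℂ) 1)
    (x : E) : symbol T z x = (T (lp.single 2 0 x)).eval z := by
  have h1 := (summable_symbol T (by simpa using hz)).of_norm.hasSum.mapL
    (ContinuousLinearMap.apply ℂ F x)
  exact h1.unique ((T (lp.single 2 0 x)).hasSum_eval hz)

theorem differentiableOn_symbol (T : Hardy E →L[ℂ] Hardy F) :
    DifferentiableOn ℂ (symbol T) (Metric.ball 0 1) := by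
  intro z hz
  obtain ⟨ρ, h1, h2⟩ := exists_between (mem_ball_zero_iff.1 hz)
  have hρ : 0 < ρ := (norm_nonneg z).trans_lt h1
  have hρ' : ‖(ρ : ℂ)‖ = ρ := by simp [abs_of_pos hρ]
  have h3 : DifferentiableOn ℂ (symbol T) (Metric.ball 0 ρ) := by
    refine differentiableOn_tsum_of_summable_norm
      (u := fun n => ‖(ρ : ℂ) ^ n • symbolCoeff T n‖) (summable_symbol T (by rw [hρ']; exact h2))
      (fun n => ?_) Metric.isOpen_ball (fun n w hw => ?_)
    · exact ((differentiable_id.pow n).smul_const _).differentiableOn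
    · rw [norm_smul, norm_smul, norm_pow, norm_pow, hρ']
      have : ‖w‖ ≤ ρ := (mem_ball_zero_iff.1 hw).le
      gcongr
  exact (h3.differentiableAt
    (Metric.isOpen_ball.mem_nhds (mem_ball_zero_iff.2 h1))).differentiableWithinAt

/-- For fixed `z` both sides are bounded in `f`, so monomials suffice. A monomial is a shift power
of a constant; `T` lets the power pass, and evaluation turns it into the factor `z ^ n`. -/
theorem eval_eq_symbol (T : Hardy E →L[ℂ] Hardy F)
    (hT : ∀ f, T (shift E f) = shift F (T f)) (f : Hardy E) {z : ℂ}
    (hz : z ∈ Metric.ball (0 : ℂ) 1) : (T f).eval z = symbol T z (f.eval z) := by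
  have h : (Hardy.evalL F z hz).comp T = (symbol T z).comp (Hardy.evalL E z hz) := by
    refine Hardy.clm_ext fun n x => ?_
    have h1 : (lp.single 2 n x : Hardy E) = (shift E ^ n) (lp.single 2 0 x) := by
      rw [shift_pow_single, zero_add]
    rw [ContinuousLinearMap.comp_apply, ContinuousLinearMap.comp_apply, Hardy.evalL_apply,
      Hardy.evalL_apply, Hardy.eval_single, map_smul, symbol_apply T hz, h1,
      commute_pow_of_commute_shift T hT, eval_shift_pow _ _ hz]
  exact congrArg (fun L => L f) h

/-- Test `T` on the Szegő kernel `k` at `z` in the direction `x`. Here `k(z) = x / (1 - |z|²)` and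
`‖k‖² = ‖x‖² / (1 - |z|²)`, so the powers of `1 - |z|²` cancel in the reproducing kernel estimate
for `T k`, leaving exactly the constant `‖T‖`. -/
theorem norm_symbol_le (T : Hardy E →L[ℂ] Hardy F)
    (hT : ∀ f, T (shift E f) = shift F (T f)) {z : ℂ} (hz : z ∈ Metric.ball (0 : ℂ) 1) :
    ‖symbol T z‖ ≤ ‖T‖ := by
  refine ContinuousLinearMap.opNorm_le_bound _ T.opNorm_nonneg fun x => ?_
  have hz1 : ‖z‖ < 1 := by simpa using hz
  have h5 : 0 < 1 - ‖z‖ ^ 2 := by nlinarith [norm_nonneg z]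
  obtain ⟨k, hk, hkn⟩ := exists_geometric x (c := conj z) (by simpa using hz1)
  rw [RCLike.norm_conj] at hkn
  have h1 : k.eval z = ((1 - ‖z‖ ^ 2 : ℝ) : ℂ)⁻¹ • x := by
    refine (k.hasSum_eval hz).unique ?_
    have h2 := (hasSum_geometric_of_norm_lt_one (ξ := z * conj z)
      (by rw [norm_mul, RCLike.norm_conj]; nlinarith [norm_nonneg z])).smul_const x
    have h3 : (1 - z * conj z) = ((1 - ‖z‖ ^ 2 : ℝ) : ℂ) := by
      rw [Complex.mul_conj, Complex.normSq_eq_norm_sq]; push_cast; ring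
    rw [h3] at h2
    simpa only [hk, smul_smul, mul_pow] using h2
  have h2 := (T k).norm_sq_eval_le hz
  rw [eval_eq_symbol T hT k hz, h1, map_smul, norm_smul, norm_inv, norm_real,
    Real.norm_of_nonneg h5.le] at h2
  have h3 : ‖T k‖ ^ 2 ≤ (‖T‖ * ‖k‖) ^ 2 := pow_le_pow_left₀ (norm_nonneg _) (T.le_opNorm k) 2
  refine le_of_sq_le_sq ?_ (by positivity)
  calc ‖symbol T z x‖ ^ 2
      = (1 - ‖z‖ ^ 2) * ((1 - ‖z‖ ^ 2) * ((1 - ‖z‖ ^ 2)⁻¹ * ‖symbol T z x‖) ^ 2) := by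
        field_simp
    _ ≤ (1 - ‖z‖ ^ 2) * (‖T‖ * ‖k‖) ^ 2 := mul_le_mul_of_nonneg_left (h2.trans h3) h5.le
    _ = (‖T‖ * ‖x‖) ^ 2 := by rw [mul_pow, mul_pow, ← hkn]; ring

/-- An operator between Hardy spaces that intertwines the shifts is multiplication by a bounded
analytic function. -/
theorem exists_mulOp_eq (T : Hardy E →L[ℂ] Hardy F)
    (hT : ∀ f, T (shift E f) = shift F (T f)) :
    ∃ Θ : HInfty E F, mulOp Θ = T ∧ ∀ z ∈ Metric.ball (0 : ℂ) 1, ‖Θ z‖ ≤ ‖T‖ := by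
  refine ⟨⟨symbol T, differentiableOn_symbol T, ‖T‖, fun z hz => norm_symbol_le T hT hz⟩, ?_,
    fun z hz => norm_symbol_le T hT hz⟩
  ext1 f
  refine Hardy.ext_eval fun z hz => ?_
  rw [eval_mulOp _ _ hz, eval_eq_symbol T hT f hz]

theorem mulOp_single_eval (Θ : HInfty E F) (x : E) {z : ℂ} (hz : z ∈ Metric.ball (0 : ℂ) 1) :
    (mulOp Θ (lp.single 2 0 x)).eval z = Θ z x := by
  rw [eval_mulOp _ _ hz, Hardy.eval_single, pow_zero, one_smul]

end Intertwining

/-! ### The Wold decomposition of a shift-invariant subspace. -/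

section Wold

variable {F : Type u} [NormedAddCommGroup F] [InnerProductSpace ℂ F] [CompleteSpace F]

/-- The shift as an isometry. -/
def shiftₗᵢ (F : Type u) [NormedAddCommGroup F] [InnerProductSpace ℂ F] [CompleteSpace F] :
    Hardy F →ₗᵢ[ℂ] Hardy F := ⟨(shift F).toLinearMap, norm_shift⟩

/-- The powers of the shift as isometries. -/
def shiftPow (F : Type u) [NormedAddCommGroup F] [InnerProductSpace ℂ F] [CompleteSpace F]
    (n : ℕ) : Hardy F →ₗᵢ[ℂ] Hardy F :=
  ⟨(shift F ^ n).toLinearMap, fun f => by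
    change ‖(shift F ^ n) f‖ = ‖f‖
    induction n with
    | zero => simp
    | succ n ih => rw [pow_succ', mul_apply_eq_comp, norm_shift, ih]⟩

theorem shiftPow_apply (n : ℕ) (f : Hardy F) : shiftPow F n f = (shift F ^ n) f := rfl

/-- The wandering subspace of a shift invariant subspace. -/
def wandering (M : Submodule ℂ (Hardy F)) : Submodule ℂ (Hardy F) :=
  M ⊓ (M.map (shift F).toLinearMap)ᗮ

theorem isClosed_wandering {M : Submodule ℂ (Hardy F)} (hM : IsClosed (M : Set (Hardy F))) :
    IsClosed (wandering M : Set (Hardy F)) :=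
  hM.inter (Submodule.isClosed_orthogonal _)

theorem shift_pow_mem {M : Submodule ℂ (Hardy F)} (hS : ∀ f ∈ M, shift F f ∈ M) (n : ℕ)
    {f : Hardy F} (hf : f ∈ M) : (shift F ^ n) f ∈ M := by
  induction n with
  | zero => simpa
  | succ n ih => rw [pow_succ', mul_apply_eq_comp]; exact hS _ ih

/-- Cancelling the smaller power, which is isometric, leaves a vector of the image of `M` under the
shift paired with a wandering vector. -/
theorem orthogonalFamily_wandering {M : Submodule ℂ (Hardy F)}
    (hS : ∀ f ∈ M, shift F f ∈ M) :
    OrthogonalFamily ℂ (fun _ : ℕ => wandering M)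
      (fun n => (shiftPow F n).comp (wandering M).subtypeₗᵢ) := by
  have key : ∀ (n k : ℕ) (v w : wandering M),
      inner ℂ (shiftPow F (n + (k + 1)) w.1) (shiftPow F n v.1) = 0 := by
    intro n k v w
    rw [shiftPow_apply, pow_add, mul_apply_eq_comp, ← shiftPow_apply n, LinearIsometry.inner_map_map]
    refine (Submodule.mem_orthogonal _ _).1 v.2.2 _ ?_
    rw [pow_succ', mul_apply_eq_comp]
    exact Submodule.mem_map_of_mem (shift_pow_mem hS k w.2.1)
  intro i j hij v w
  rcases lt_or_gt_of_ne hij with h | h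
  · obtain ⟨k, rfl⟩ := Nat.exists_eq_add_of_lt h
    exact inner_eq_zero_symm.1 (key i k v w)
  · obtain ⟨k, rfl⟩ := Nat.exists_eq_add_of_lt h
    exact key j k w v

/-- The Wold decomposition of a shift invariant subspace. -/
theorem exists_isometry_range_eq {M : Submodule ℂ (Hardy F)} (hM : IsClosed (M : Set (Hardy F)))
    (hS : ∀ f ∈ M, shift F f ∈ M) [CompleteSpace (wandering M)] :
    ∃ T : Hardy (wandering M) →ₗᵢ[ℂ] Hardy F,
      (∀ f, T (shift _ f) = shift F (T f)) ∧ T.toLinearMap.range = M := by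
  have hO := orthogonalFamily_wandering hS
  set T := hO.linearIsometry with hTdef
  have hTs : ∀ n (w : wandering M), T (lp.single 2 n w) = (shift F ^ n) w.1 := fun n w =>
    hO.linearIsometry_apply_single w
  refine ⟨T, fun f => ?_, le_antisymm ?_ ?_⟩
  · have h : T.toContinuousLinearMap.comp (shift _) = (shift F).comp T.toContinuousLinearMap := by
      refine Hardy.clm_ext fun n x => ?_
      change T (shift _ (lp.single 2 n x)) = shift F (T (lp.single 2 n x))
      rw [shift_single, hTs, hTs, pow_succ', mul_apply_eq_comp]
    exact congrArg (fun L => L f) h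
  · rintro _ ⟨f, rfl⟩
    refine hM.mem_of_tendsto (hO.hasSum_linearIsometry f) (Eventually.of_forall fun s => ?_)
    exact Submodule.sum_mem _ fun n _ => shift_pow_mem hS n (f n).2.1
  · have hcl : IsClosed (T.toLinearMap.range : Set (Hardy F)) := by
      have := T.isometry.isClosedEmbedding.isClosed_range
      rwa [← LinearIsometry.coe_toLinearMap, ← LinearMap.coe_range] at this
    have hSM : IsClosed (M.map (shift F).toLinearMap : Set (Hardy F)) :=
      ((shiftₗᵢ F).isometry.isClosedEmbedding.isClosedMap) _ hM
    have : CompleteSpace T.toLinearMap.range := hcl.completeSpace_coe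
    have : CompleteSpace (M.map (shift F).toLinearMap) := hSM.completeSpace_coe
    have hrle : T.toLinearMap.range ≤ M := by
      rintro _ ⟨f, rfl⟩
      refine hM.mem_of_tendsto (hO.hasSum_linearIsometry f) (Eventually.of_forall fun s => ?_)
      exact Submodule.sum_mem _ fun n _ => shift_pow_mem hS n (f n).2.1
    intro x hx
    obtain ⟨p, hp, q, hq, rfl⟩ := T.toLinearMap.range.exists_add_mem_mem_orthogonal x
    have hqM : q ∈ M := by simpa using M.sub_mem hx (hrle hp)
    -- The part `q` of `x` orthogonal to the range lies in every `Sⁿ M`, hence vanishes by purity.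
    -- If `q = Sⁿ y`, split `y = a + b` with `a ∈ S M` and `b` wandering. Then `Sⁿ b` is in the
    -- range of `T`, so it is orthogonal to `q = Sⁿ a + Sⁿ b`; as `b ⊥ a`, this forces `b = 0`.
    have key : ∀ n, ∃ y ∈ M, (shift F ^ n) y = q := by
      intro n
      induction n with
      | zero => exact ⟨q, hqM, by simp⟩
      | succ n ih =>
        obtain ⟨y, hy, hyq⟩ := ih
        obtain ⟨a, ha, b, hb, rfl⟩ := (M.map (shift F).toLinearMap).exists_add_mem_mem_orthogonal y
        have hbM : b ∈ M := by
          have haM : a ∈ M := by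
            obtain ⟨c, hc, rfl⟩ := ha
            exact hS c hc
          simpa using M.sub_mem hy haM
        have h1 : inner ℂ ((shift F ^ n) b) q = 0 :=
          (Submodule.mem_orthogonal _ _).1 hq _ ⟨_, hTs n ⟨b, hbM, hb⟩⟩
        rw [← hyq, ← shiftPow_apply, ← shiftPow_apply, LinearIsometry.inner_map_map, inner_add_right,
          inner_eq_zero_symm.1 ((Submodule.mem_orthogonal _ _).1 hb a ha), zero_add,
          inner_self_eq_zero] at h1
        obtain ⟨c, hc, rfl⟩ := ha
        refine ⟨c, hc, ?_⟩
        rw [← hyq, h1, add_zero, pow_succ, mul_apply_eq_comp]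
        rfl
    have hq0 : q = 0 := isPureIsometry_shift.2 q fun n => (key n).imp fun y hy => hy.2
    rwa [hq0, add_zero]

end Wold

/-! ### From a derivative along the circle to a radial limit of the derivative. -/

section RadialDerivative

variable {F : Type u} [NormedAddCommGroup F] [NormedSpace ℂ F] [CompleteSpace F]

/-- The Cauchy formula for the derivative of a function that is only continuous up to the
boundary. -/
theorem circleIntegral_sq_inv_smul {H : ℂ → F} (hc : DiffContOnCl ℂ H (Metric.ball 0 1)) {z : ℂ}
    (hz : z ∈ Metric.ball (0 : ℂ) 1) :
    ∮ ζ in C(0, 1), ((ζ - z) ^ 2)⁻¹ • H ζ = (2 * Real.pi * I : ℂ) • deriv H z := by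
  have hH : ContinuousOn H (Metric.closedBall 0 1) := hc.continuousOn_ball
  -- The Cauchy integral formula applied to the divided difference of `H` at `z`, whose value at `z`
  -- is the derivative; the constant `H z` contributes nothing, since `(ζ - z)⁻²` has integral 0.
  have hd : DiffContOnCl ℂ (dslope H z) (Metric.ball 0 1) := by
    refine ⟨(Complex.differentiableOn_dslope (Metric.isOpen_ball.mem_nhds hz)).2
      hc.differentiableOn, ?_⟩
    rw [closure_ball _ one_ne_zero]
    exact (continuousOn_dslope (mem_of_superset (Metric.isOpen_ball.mem_nhds hz)
      Metric.ball_subset_closedBall)).2 ⟨hH, hc.differentiableAt Metric.isOpen_ball hz⟩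
  have h0 := hd.circleIntegral_sub_inv_smul hz
  rw [dslope_same] at h0
  rw [← h0]
  have hne : ∀ ζ ∈ Metric.sphere (0 : ℂ) 1, ζ ≠ z := fun ζ hζ =>
    Metric.sphere_disjoint_ball.ne_of_mem hζ hz
  trans ∮ ζ in C(0, 1), ((ζ - z) ^ 2)⁻¹ • (H ζ - H z)
  · have h1 : ContinuousOn (fun ζ : ℂ => ((ζ - z) ^ 2)⁻¹) (Metric.sphere 0 1) := by
      refine ((continuous_id'.sub continuous_const).pow 2).continuousOn.inv₀ fun w hw h => ?_
      exact hne w hw (sub_eq_zero.mp (sq_eq_zero_iff.mp h))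
    have h2 : CircleIntegrable (fun ζ : ℂ => ((ζ - z) ^ 2)⁻¹ • H ζ) 0 1 :=
      ContinuousOn.circleIntegrable zero_le_one
        (h1.smul (hH.mono Metric.sphere_subset_closedBall))
    have h3 : CircleIntegrable (fun ζ : ℂ => ((ζ - z) ^ 2)⁻¹ • H z) 0 1 :=
      ContinuousOn.circleIntegrable zero_le_one (h1.smul continuousOn_const)
    have h4 : (∮ ζ : ℂ in C(0, 1), ((ζ - z) ^ 2)⁻¹) = 0 := by
      simpa using! circleIntegral.integral_sub_zpow_of_ne (by decide : (-2 : ℤ) ≠ -1) 0 z 1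
    simp only [smul_sub, circleIntegral.integral_sub h2 h3, h4, circleIntegral.integral_smul_const,
      zero_smul, sub_zero]
  · refine circleIntegral.integral_congr zero_le_one fun ζ hζ => ?_
    simp only [dslope_of_ne _ (hne ζ hζ), slope, ← smul_assoc, sq, mul_inv, vsub_eq_sub,
      smul_eq_mul]

/-- On the unit circle the distances to a point and to its reflection are proportional, because `|ζ
- rζ₀| = |rζ - ζ₀|`. -/
theorem norm_sub_inv_mul {ζ ζ₀ : ℂ} (hζ : ‖ζ‖ = 1) (hζ₀ : ‖ζ₀‖ = 1) {r : ℝ} (hr : 0 < r) :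
    ‖ζ - (r : ℂ)⁻¹ * ζ₀‖ = r⁻¹ * ‖ζ - r * ζ₀‖ := by
  have h1 : ‖ζ - r * ζ₀‖ = ‖r * ζ - ζ₀‖ := by
    rw [← sq_eq_sq₀ (norm_nonneg _) (norm_nonneg _), ← normSq_eq_norm_sq, ← normSq_eq_norm_sq,
      normSq_sub, normSq_sub]
    simp only [normSq_eq_norm_sq, norm_real, hζ, hζ₀, map_mul, conj_ofReal]
    have : (ζ * (r * conj ζ₀)).re = (r * ζ * conj ζ₀).re := by congr 1; ring
    rw [this]
    ring
  have h2 : ζ - (r : ℂ)⁻¹ * ζ₀ = (r : ℂ)⁻¹ * (r * ζ - ζ₀) := by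
    have : (r : ℂ) ≠ 0 := by exact_mod_cast hr.ne'
    field_simp
  rw [h2, norm_mul, h1, norm_inv, norm_real, Real.norm_of_nonneg hr.le]

/-- The difference of the Cauchy kernels at `r ζ₀` and at its reflection in the unit circle. -/
theorem norm_reflected_kernel_le {ζ ζ₀ : ℂ} (hζ : ‖ζ‖ = 1) (hζ₀ : ‖ζ₀‖ = 1) {r : ℝ} (hr : 0 < r)
    (hr1 : r < 1) :
    ‖((ζ - r * ζ₀) ^ 2)⁻¹ - ((ζ - (r : ℂ)⁻¹ * ζ₀) ^ 2)⁻¹‖ * ‖ζ - ζ₀‖ ≤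
      10 * ((1 - r ^ 2) / ‖ζ - r * ζ₀‖ ^ 2) := by
  set d := ‖ζ - r * ζ₀‖ with hd
  set s := ‖ζ - ζ₀‖ with hs
  have hr0 : (r : ℂ) ≠ 0 := by exact_mod_cast hr.ne'
  have hd1 : 1 - r ≤ d := by
    have := norm_sub_norm_le ζ (r * ζ₀)
    rwa [norm_mul, norm_real, Real.norm_of_nonneg hr.le, hζ, hζ₀, mul_one] at this
  have hd0 : 0 < d := by linarith
  have h1 : ‖(1 - r : ℂ) * ζ₀‖ = 1 - r := by
    rw [norm_mul, hζ₀, mul_one, ← ofReal_one, ← ofReal_sub, norm_real,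
      Real.norm_of_nonneg (by linarith)]
  have hs1 : s ≤ 2 * d := by
    have h2 : ζ - ζ₀ = (ζ - r * ζ₀) - (1 - r) * ζ₀ := by ring
    have := norm_sub_le (ζ - r * ζ₀) ((1 - r) * ζ₀)
    rw [← h2, h1] at this
    linarith
  have hs0 : 0 ≤ s := norm_nonneg _
  have hw := norm_sub_inv_mul hζ hζ₀ hr
  rw [← hd] at hw
  have hz0 : ζ - r * ζ₀ ≠ 0 := norm_pos_iff.1 hd0
  have hw0 : ζ - (r : ℂ)⁻¹ * ζ₀ ≠ 0 := norm_pos_iff.1 (by rw [hw]; positivity)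
  -- Difference of two squares. The second factor of the numerator uses `r + r⁻¹ = 2 + r⁻¹(1 - r)²`,
  -- which displays its smallness near `ζ₀`.
  have h3 : ((ζ - r * ζ₀) ^ 2)⁻¹ - ((ζ - (r : ℂ)⁻¹ * ζ₀) ^ 2)⁻¹ =
      ((r : ℂ)⁻¹ * (r ^ 2 - 1) * ζ₀) * (2 * (ζ - ζ₀) - (r : ℂ)⁻¹ * ((1 - r) ^ 2 * ζ₀)) /
        ((ζ - r * ζ₀) ^ 2 * (ζ - (r : ℂ)⁻¹ * ζ₀) ^ 2) := by
    rw [inv_sub_inv (pow_ne_zero 2 hz0) (pow_ne_zero 2 hw0)]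
    congr 1
    field_simp
    ring
  have h4 : ‖(r : ℂ)⁻¹ * (r ^ 2 - 1) * ζ₀‖ = r⁻¹ * (1 - r ^ 2) := by
    have : (r : ℂ) ^ 2 - 1 = ((r ^ 2 - 1 : ℝ) : ℂ) := by push_cast; ring
    rw [norm_mul, norm_mul, hζ₀, mul_one, this, norm_inv, norm_real, norm_real,
      Real.norm_of_nonneg hr.le, Real.norm_of_nonpos (by nlinarith)]
    ring
  have h5 : ‖2 * (ζ - ζ₀) - (r : ℂ)⁻¹ * ((1 - r) ^ 2 * ζ₀)‖ ≤ 2 * s + r⁻¹ * (1 - r) ^ 2 := by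
    have h6 : ‖(r : ℂ)⁻¹ * ((1 - r) ^ 2 * ζ₀)‖ = r⁻¹ * (1 - r) ^ 2 := by
      have : (1 - (r : ℂ)) ^ 2 = (((1 - r) ^ 2 : ℝ) : ℂ) := by push_cast; ring
      rw [norm_mul, norm_mul, hζ₀, mul_one, this, norm_inv, norm_real, norm_real,
        Real.norm_of_nonneg hr.le, Real.norm_of_nonneg (sq_nonneg _)]
    refine (norm_sub_le _ _).trans ?_
    rw [h6, norm_mul]
    simp [hs]
  -- From `s ≤ 2d` and `(1 - r)² ≤ 1 - r ≤ d` the bracket is at most `5d`; the remaining `s`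
  -- contributes `2d`.
  have h7 : (2 * r * s + (1 - r) ^ 2) * s ≤ 10 * d ^ 2 := by
    have : 2 * r * s + (1 - r) ^ 2 ≤ 5 * d := by nlinarith
    nlinarith
  have h8 : 0 ≤ 1 - r ^ 2 := by nlinarith
  rw [h3, norm_div, norm_mul, h4, norm_mul, norm_pow, norm_pow, hw, ← hd]
  calc r⁻¹ * (1 - r ^ 2) * ‖2 * (ζ - ζ₀) - (r : ℂ)⁻¹ * ((1 - r) ^ 2 * ζ₀)‖ /
        (d ^ 2 * (r⁻¹ * d) ^ 2) * s
      ≤ r⁻¹ * (1 - r ^ 2) * (2 * s + r⁻¹ * (1 - r) ^ 2) / (d ^ 2 * (r⁻¹ * d) ^ 2) * s := by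
        gcongr
    _ = (1 - r ^ 2) * ((2 * r * s + (1 - r) ^ 2) * s) / d ^ 4 := by
        field_simp
    _ ≤ (1 - r ^ 2) * (10 * d ^ 2) / d ^ 4 := by gcongr
    _ = _ := by field_simp

theorem integral_poisson {w : ℂ} (hw : w ∈ Metric.ball (0 : ℂ) 1) :
    ∫ t in (0 : ℝ)..(2 * Real.pi), (1 - ‖w‖ ^ 2) / ‖circleMap 0 1 t - w‖ ^ 2 = 2 * Real.pi := by
  have h := (diffContOnCl_const (𝕜 := ℂ) (c := (1 : ℂ))
    (s := Metric.ball (0 : ℂ) 1)).circleAverage_poissonKernel_smul' hw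
  rw [Real.circleAverage_def] at h
  simp only [sub_zero, norm_circleMap_zero, abs_one, one_pow, real_smul, mul_one] at h
  rw [intervalIntegral.integral_ofReal, ← ofReal_mul, ← ofReal_one, ofReal_inj] at h
  rwa [inv_mul_eq_one₀ (by positivity), eq_comm] at h

/-- If a function in the disc algebra has, at a boundary point, a derivative along the circle, then
this is the radial limit of its derivative. -/
theorem tendsto_deriv_radial {G : ℂ → F} (hG : DiffContOnCl ℂ G (Metric.ball 0 1)) {ζ₀ : ℂ}
    (hζ₀ : ‖ζ₀‖ = 1) {a : F}
    (h : ∀ ε > 0, ∃ C ≥ 0, ∀ ζ, ‖ζ‖ = 1 →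
      ‖G ζ - G ζ₀ - (ζ - ζ₀) • a‖ ≤ (ε + C * ‖ζ - ζ₀‖ ^ 2) * ‖ζ - ζ₀‖) :
    Tendsto (fun r : ℝ => deriv G (r * ζ₀)) (𝓝[<] 1) (𝓝 a) := by
  set H : ℂ → F := fun ζ => G ζ - G ζ₀ - (ζ - ζ₀) • a with hHdef
  have hH : DiffContOnCl ℂ H (Metric.ball 0 1) :=
    (hG.sub_const _).sub (((differentiable_id.sub_const ζ₀).smul_const a).diffContOnCl)
  -- The kernel difference times `|ζ - ζ₀|` is at most 10 Poisson kernels, of total mass 1, so the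
  -- `ε` term contributes `10ε`. In the `C` term, `|ζ - ζ₀|² ≤ 4|ζ - rζ₀|²` cancels the Poisson
  -- denominator and leaves `40C(1 - r²)`, which tends to 0.
  have key : ∀ ε > 0, ∀ C ≥ 0, (∀ ζ, ‖ζ‖ = 1 →
      ‖H ζ‖ ≤ (ε + C * ‖ζ - ζ₀‖ ^ 2) * ‖ζ - ζ₀‖) → ∀ r : ℝ, 0 < r → r < 1 →
      ‖deriv G (r * ζ₀) - a‖ ≤ 10 * ε + 40 * C * (1 - r ^ 2) := by
    intro ε hε C hC hb r hr hr1
    have hrn : ‖(r : ℂ) * ζ₀‖ = r := by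
      rw [norm_mul, norm_real, Real.norm_of_nonneg hr.le, hζ₀, mul_one]
    have hz : (r : ℂ) * ζ₀ ∈ Metric.ball (0 : ℂ) 1 := by rwa [mem_ball_zero_iff, hrn]
    have hr0 : (r : ℂ) ≠ 0 := by exact_mod_cast hr.ne'
    have hwn : ‖(r : ℂ)⁻¹ * ζ₀‖ = r⁻¹ := by
      rw [norm_mul, norm_inv, norm_real, Real.norm_of_nonneg hr.le, hζ₀, mul_one]
    have hdz : deriv H (r * ζ₀) = deriv G (r * ζ₀) - a := by
      have h1 := (hG.differentiableAt Metric.isOpen_ball hz).hasDerivAt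
      have h2 : HasDerivAt (fun ζ : ℂ => (ζ - ζ₀) • a) ((1 : ℂ) • a) (r * ζ₀) :=
        ((hasDerivAt_id _).sub_const ζ₀).smul_const a
      rw [one_smul] at h2
      exact ((h1.sub_const (G ζ₀)).sub h2).deriv
    have hwne : ∀ ζ ∈ Metric.closedBall (0 : ℂ) 1, ζ - (r : ℂ)⁻¹ * ζ₀ ≠ 0 := by
      intro ζ hζ h0
      rw [sub_eq_zero.1 h0, mem_closedBall_zero_iff, hwn] at hζ
      exact absurd ((one_lt_inv₀ hr).2 hr1) (not_lt.2 hζ)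
    have hzne : ∀ ζ ∈ Metric.sphere (0 : ℂ) 1, ζ - (r : ℂ) * ζ₀ ≠ 0 := fun ζ hζ h0 =>
      Metric.sphere_disjoint_ball.ne_of_mem hζ hz (sub_eq_zero.1 h0)
    have hHc : ContinuousOn H (Metric.closedBall 0 1) := hH.continuousOn_ball
    have hA := circleIntegral_sq_inv_smul hH hz
    -- The reflected point lies outside the closed disc, so its kernel can be subtracted for free.
    -- This is what brings the kernel down to Poisson size.
    have hB : ∮ ζ in C(0, 1), ((ζ - (r : ℂ)⁻¹ * ζ₀) ^ 2)⁻¹ • H ζ = 0 := by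
      refine DiffContOnCl.circleIntegral_eq_zero zero_le_one ⟨?_, ?_⟩
      · refine DifferentiableOn.smul (DifferentiableOn.inv (by fun_prop) fun ζ hζ => ?_)
          hH.differentiableOn
        exact pow_ne_zero 2 (hwne ζ (Metric.ball_subset_closedBall hζ))
      · rw [closure_ball _ one_ne_zero]
        refine ContinuousOn.smul (ContinuousOn.inv₀ (by fun_prop) fun ζ hζ => ?_) hHc
        exact pow_ne_zero 2 (hwne ζ hζ)
    have hHs := hHc.mono Metric.sphere_subset_closedBall
    have hcA : ContinuousOn (fun ζ => ((ζ - (r : ℂ) * ζ₀) ^ 2)⁻¹ • H ζ) (Metric.sphere 0 1) :=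
      ContinuousOn.smul (ContinuousOn.inv₀ (by fun_prop) fun ζ hζ =>
        pow_ne_zero 2 (hzne ζ hζ)) hHs
    have hcB : ContinuousOn (fun ζ => ((ζ - (r : ℂ)⁻¹ * ζ₀) ^ 2)⁻¹ • H ζ) (Metric.sphere 0 1) :=
      ContinuousOn.smul (ContinuousOn.inv₀ (by fun_prop) fun ζ hζ =>
        pow_ne_zero 2 (hwne ζ (Metric.sphere_subset_closedBall hζ))) hHs
    have hAB := circleIntegral.integral_sub (hcA.circleIntegrable zero_le_one)
      (hcB.circleIntegrable zero_le_one)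
    rw [hA, hB, sub_zero, hdz] at hAB
    have hcirc : ∀ t : ℝ, ‖circleMap 0 1 t‖ = 1 := fun t => by simp
    have hpc : Continuous fun t : ℝ =>
        (1 - ‖(r : ℂ) * ζ₀‖ ^ 2) / ‖circleMap 0 1 t - r * ζ₀‖ ^ 2 := by
      refine continuous_const.div ((((continuous_circleMap 0 1).sub continuous_const).norm).pow 2)
        fun t => pow_ne_zero 2 (norm_ne_zero_iff.2 (hzne _ (by simp)))
    have hle : ‖(2 * Real.pi * I : ℂ) • (deriv G (r * ζ₀) - a)‖ ≤
        ∫ t in (0 : ℝ)..(2 * Real.pi), (10 * ε *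
          ((1 - ‖(r : ℂ) * ζ₀‖ ^ 2) / ‖circleMap 0 1 t - r * ζ₀‖ ^ 2) +
            40 * C * (1 - r ^ 2)) := by
      rw [← hAB, circleIntegral]
      refine intervalIntegral.norm_integral_le_of_norm_le Real.two_pi_pos.le
        (ae_of_all _ fun t _ => ?_) ((by fun_prop : Continuous _).intervalIntegrable _ _)
      set ζ := circleMap 0 1 t with hζdef
      have hζ : ‖ζ‖ = 1 := hcirc t
      rw [norm_smul, deriv_circleMap, norm_mul, norm_I, mul_one, norm_circleMap_zero, abs_one,
        one_mul, ← sub_smul, norm_smul, hrn]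
      have hK := norm_reflected_kernel_le hζ hζ₀ hr hr1
      have hd0 : 0 < ‖ζ - r * ζ₀‖ := norm_pos_iff.2 (hzne ζ (by simpa using hζ))
      have hs2 : ‖ζ - ζ₀‖ ≤ 2 * ‖ζ - r * ζ₀‖ := by
        have h1 : ‖(1 - r : ℂ) * ζ₀‖ = 1 - r := by
          rw [norm_mul, hζ₀, mul_one, ← ofReal_one, ← ofReal_sub, norm_real,
            Real.norm_of_nonneg (by linarith)]
        have h2 : ζ - ζ₀ = (ζ - r * ζ₀) - (1 - r) * ζ₀ := by ring
        have h3 := norm_sub_le (ζ - r * ζ₀) ((1 - r) * ζ₀)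
        have h4 := norm_sub_norm_le ζ (r * ζ₀)
        rw [hrn, hζ] at h4
        rw [← h2, h1] at h3
        linarith
      have h8 : 0 ≤ 1 - r ^ 2 := by nlinarith
      set K := ‖((ζ - r * ζ₀) ^ 2)⁻¹ - ((ζ - (r : ℂ)⁻¹ * ζ₀) ^ 2)⁻¹‖ with hKdef
      calc K * ‖H ζ‖ ≤ K * ((ε + C * ‖ζ - ζ₀‖ ^ 2) * ‖ζ - ζ₀‖) := by
            gcongr
            exact hb ζ hζ
        _ = (K * ‖ζ - ζ₀‖) * (ε + C * ‖ζ - ζ₀‖ ^ 2) := by ring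
        _ ≤ (10 * ((1 - r ^ 2) / ‖ζ - r * ζ₀‖ ^ 2)) * (ε + C * (2 * ‖ζ - r * ζ₀‖) ^ 2) := by
            gcongr
        _ = _ := by field_simp; ring
    rw [intervalIntegral.integral_add ((hpc.const_mul _).intervalIntegrable _ _)
      (continuous_const.intervalIntegrable _ _), intervalIntegral.integral_const_mul,
      integral_poisson hz, intervalIntegral.integral_const, norm_smul] at hle
    have h2pi : ‖(2 * Real.pi * I : ℂ)‖ = 2 * Real.pi := by
      simp [abs_of_pos Real.pi_pos]
    rw [h2pi, sub_zero, smul_eq_mul] at hle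
    refine le_of_mul_le_mul_left (hle.trans (le_of_eq ?_)) Real.two_pi_pos
    ring
  refine Metric.tendsto_nhds.2 fun δ hδ => ?_
  -- With `ε = δ/20` the limit of the bound is `10ε = δ/2 < δ`.
  obtain ⟨C, hC, hb⟩ := h (δ / 20) (by positivity)
  have hlim : Tendsto (fun r : ℝ => 10 * (δ / 20) + 40 * C * (1 - r ^ 2)) (𝓝[<] 1)
      (𝓝 (δ / 2)) := by
    have hcont : Continuous fun r : ℝ => 10 * (δ / 20) + 40 * C * (1 - r ^ 2) := by fun_prop
    have := (hcont.tendsto 1).mono_left (nhdsWithin_le_nhds (s := Set.Iio 1))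
    convert! this using 2
    ring
  filter_upwards [hlim.eventually (gt_mem_nhds (half_lt_self hδ)),
    Ioo_mem_nhdsLT (zero_lt_one' ℝ)] with r h1 h2
  rw [dist_eq_norm]
  exact (key _ (by positivity) C hC hb r h2.1 h2.2).trans_lt h1

end RadialDerivative

/-! ### Fatou's theorem for the Hilbert-space valued Hardy space. -/

section Fatou

/-- Jordan's inequality for `sin (u / 2)`: arc length is at most `π/2` times the chord. -/
theorem abs_le_norm_exp_sub_one {u : ℝ} (hu : |u| ≤ Real.pi) :
    |u| ≤ Real.pi / 2 * ‖exp ((u : ℂ) * I) - 1‖ := by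
  rw [mul_comm (u : ℂ), norm_exp_I_mul_ofReal_sub_one, norm_mul, Real.norm_eq_abs,
    Real.norm_eq_abs, abs_two]
  have h := Real.mul_abs_le_abs_sin (x := u / 2) (by rw [abs_div, abs_two]; linarith)
  rw [abs_div, abs_two] at h
  have hpi := Real.pi_pos
  calc |u| = Real.pi / 2 * (2 * (2 / Real.pi * (|u| / 2))) := by field_simp
    _ ≤ _ := by gcongr

/-- A property of the points of the circle that holds almost everywhere on one period holds
almost everywhere. -/
theorem ae_circle_of_ae_restrict {P : ℂ → Prop}
    (h : ∀ᵐ t : ℝ, t ∈ Set.Ioc 0 (2 * Real.pi) → P (exp ((t : ℂ) * I))) :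
    ∀ᵐ t : ℝ, P (exp ((t : ℂ) * I)) := by
  -- Translations preserve null sets, and only countably many are needed to bring every `t` into one
  -- period.
  have h1 : ∀ k : ℤ, ∀ᵐ t : ℝ, t + k • (2 * Real.pi) ∈ Set.Ioc 0 (2 * Real.pi) →
      P (exp (((t + k • (2 * Real.pi) : ℝ) : ℂ) * I)) := fun k =>
    (measurePreserving_add_right volume (k • (2 * Real.pi))).quasiMeasurePreserving.ae h
  filter_upwards [ae_all_iff.2 h1] with t ht
  obtain ⟨k, hk, -⟩ := existsUnique_add_zsmul_mem_Ioc Real.two_pi_pos t 0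
  rw [zero_add] at hk
  have h2 := ht k hk
  have h3 : exp (((t + k • (2 * Real.pi) : ℝ) : ℂ) * I) = exp ((t : ℂ) * I) := by
    rw [← exp_periodic.int_mul k ((t : ℂ) * I)]
    congr 1
    push_cast [zsmul_eq_mul]
    ring
  rwa [h3] at h2

variable {F : Type u} [NormedAddCommGroup F] [InnerProductSpace ℂ F] [CompleteSpace F]

/-- Differentiability along the circle gives the estimate of `tendsto_deriv_radial`. -/
theorem tendsto_deriv_radial_of_hasDerivAt {G : ℂ → F}
    (hG : DiffContOnCl ℂ G (Metric.ball 0 1)) {t : ℝ} {b : F}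
    (hb : HasDerivAt (fun s : ℝ => G (exp ((s : ℂ) * I))) b t) :
    Tendsto (fun r : ℝ => deriv G (r * exp ((t : ℂ) * I))) (𝓝[<] 1)
      (𝓝 ((exp ((t : ℂ) * I) * I)⁻¹ • b)) := by
  set ζ₀ := exp ((t : ℂ) * I) with hζ₀def
  have hζ₀ : ‖ζ₀‖ = 1 := norm_exp_ofReal_mul_I t
  have hζ₀0 : ζ₀ ≠ 0 := exp_ne_zero _
  set a := (ζ₀ * I)⁻¹ • b with ha
  refine tendsto_deriv_radial hG hζ₀ fun ε hε => ?_
  have hexp : HasDerivAt (fun s : ℝ => exp ((s : ℂ) * I)) (ζ₀ * I) t := by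
    have h1 : HasDerivAt (fun s : ℝ => (s : ℂ) * I) (1 * I) t :=
      (Complex.ofRealCLM.hasDerivAt (x := t)).mul_const I
    rw [one_mul] at h1
    exact h1.cexp
  have hH : HasDerivAt (fun s : ℝ => G (exp ((s : ℂ) * I)) - G ζ₀ - (exp ((s : ℂ) * I) - ζ₀) • a)
      0 t := by
    have h1 := (hb.sub_const (G ζ₀)).sub ((hexp.sub_const ζ₀).smul_const a)
    rwa [ha, smul_inv_smul₀ (mul_ne_zero hζ₀0 I_ne_zero), sub_self] at h1
  have hpi := Real.pi_pos
  -- The factor `2/π` absorbs the later passage from arc length to chord.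
  have hlo := hH.isLittleO.def (show (0 : ℝ) < ε * (2 / Real.pi) by positivity)
  obtain ⟨η, hη, hball⟩ := Metric.eventually_nhds_iff.1 hlo
  have hHc : ContinuousOn (fun ζ => G ζ - G ζ₀ - (ζ - ζ₀) • a) (Metric.sphere 0 1) := by
    have := hG.continuousOn_ball.mono Metric.sphere_subset_closedBall
    fun_prop
  obtain ⟨B, hB⟩ := (isCompact_sphere (0 : ℂ) 1).exists_bound_of_continuousOn hHc
  have hB0 : 0 ≤ B := (norm_nonneg _).trans (hB ζ₀ (by simpa using hζ₀))
  -- An arc of length at least `η` has chord at least `δ`. There the crude bound `B` is at most `(B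
  -- / δ³)|ζ - ζ₀|³`, which is the `C` term; on shorter arcs the `ε` term suffices.
  set δ := η * (2 / Real.pi) with hδ
  have hδ0 : 0 < δ := by positivity
  refine ⟨B / δ ^ 3, by positivity, fun ζ hζ => ?_⟩
  set u := arg (ζ / ζ₀) with hu
  have hun : exp ((u : ℂ) * I) = ζ / ζ₀ := by
    have := norm_mul_exp_arg_mul_I (ζ / ζ₀)
    rwa [norm_div, hζ, hζ₀, div_one, ofReal_one, one_mul] at this
  have hus : |u| ≤ Real.pi / 2 * ‖ζ - ζ₀‖ := by
    have h1 := abs_le_norm_exp_sub_one (abs_arg_le_pi (ζ / ζ₀))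
    rw [← hu, hun] at h1
    have h2 : ζ / ζ₀ - 1 = (ζ - ζ₀) / ζ₀ := by field_simp
    rwa [h2, norm_div, hζ₀, div_one] at h1
  have hζu : exp (((t + u : ℝ) : ℂ) * I) = ζ := by
    rw [ofReal_add, add_mul, exp_add, hun, ← hζ₀def, mul_div_cancel₀ _ hζ₀0]
  rcases lt_or_ge |u| η with hlt | hge
  · have h1 := hball (y := t + u) (by rw [Real.dist_eq, add_sub_cancel_left]; exact hlt)
    rw [hζu, ← hζ₀def, sub_self (G ζ₀), sub_self ζ₀, zero_smul, smul_zero, sub_zero, sub_zero,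
      sub_zero, add_sub_cancel_left, Real.norm_eq_abs] at h1
    calc ‖G ζ - G ζ₀ - (ζ - ζ₀) • a‖ ≤ ε * (2 / Real.pi) * |u| := h1
      _ ≤ ε * (2 / Real.pi) * (Real.pi / 2 * ‖ζ - ζ₀‖) := by gcongr
      _ = (ε + 0) * ‖ζ - ζ₀‖ := by field_simp; ring
      _ ≤ _ := by gcongr; positivity
  · have h1 : δ ≤ ‖ζ - ζ₀‖ := by
      calc δ ≤ (Real.pi / 2 * ‖ζ - ζ₀‖) * (2 / Real.pi) := by
            rw [hδ]; gcongr; exact hge.trans hus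
        _ = _ := by field_simp
    calc ‖G ζ - G ζ₀ - (ζ - ζ₀) • a‖ ≤ B := hB ζ (by simpa using hζ)
      _ = B / δ ^ 3 * δ ^ 3 := by field_simp
      _ ≤ B / δ ^ 3 * ‖ζ - ζ₀‖ ^ 3 := by gcongr
      _ = (0 + B / δ ^ 3 * ‖ζ - ζ₀‖ ^ 2) * ‖ζ - ζ₀‖ := by ring
      _ ≤ _ := by gcongr

/-- The primitive of an element of the Hardy space that vanishes at the origin. -/
def Hardy.primitive (f : Hardy F) (z : ℂ) : F :=
  ∑' n : ℕ, z ^ (n + 1) • ((n + 1 : ℂ)⁻¹ • f n)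

/-- By `ab ≤ a² + b²` with `a = 1/(n+1)` and `b = ‖f n‖`. This absolute summability makes the
primitive continuous up to the boundary, which `f` itself need not be. -/
theorem Hardy.summable_primitive (f : Hardy F) :
    Summable fun n : ℕ => ‖(n + 1 : ℂ)⁻¹ • f n‖ := by
  have h1 : Summable fun n : ℕ => 1 / ((n : ℝ) + 1) ^ 2 := by
    have := (summable_nat_add_iff 1).2 (Real.summable_one_div_nat_pow.2 one_lt_two)
    simpa using this
  refine Summable.of_nonneg_of_le (fun _ => norm_nonneg _) (fun n => ?_)
    (f.norm_sq_hasSum.summable.add h1)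
  have h2 : ‖(n + 1 : ℂ)⁻¹‖ = 1 / ((n : ℝ) + 1) := by
    rw [norm_inv, one_div]
    norm_cast
  rw [norm_smul, h2, ← one_div_pow]
  nlinarith [sq_nonneg (1 / ((n : ℝ) + 1) - ‖f n‖), sq_nonneg (1 / ((n : ℝ) + 1) + ‖f n‖)]

theorem Hardy.norm_primitive_term_le (f : Hardy F) (n : ℕ) {z : ℂ} (hz : ‖z‖ ≤ 1) :
    ‖z ^ (n + 1) • ((n + 1 : ℂ)⁻¹ • f n)‖ ≤ ‖(n + 1 : ℂ)⁻¹ • f n‖ := by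
  rw [norm_smul, norm_pow]
  exact mul_le_of_le_one_left (norm_nonneg _) (pow_le_one₀ (norm_nonneg _) hz)

theorem Hardy.hasSum_primitive (f : Hardy F) {z : ℂ} (hz : ‖z‖ ≤ 1) :
    HasSum (fun n : ℕ => z ^ (n + 1) • ((n + 1 : ℂ)⁻¹ • f n)) (f.primitive z) :=
  (Summable.of_norm_bounded f.summable_primitive
    fun n => f.norm_primitive_term_le n hz).hasSum

theorem Hardy.differentiableOn_primitive (f : Hardy F) :
    DifferentiableOn ℂ f.primitive (Metric.ball 0 1) :=
  differentiableOn_tsum_of_summable_norm f.summable_primitive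
    (fun n => ((differentiable_id.pow (n + 1)).smul_const _).differentiableOn)
    Metric.isOpen_ball fun n _ hw => f.norm_primitive_term_le n (mem_ball_zero_iff.1 hw).le

theorem Hardy.diffContOnCl_primitive (f : Hardy F) :
    DiffContOnCl ℂ f.primitive (Metric.ball 0 1) := by
  refine ⟨f.differentiableOn_primitive, ?_⟩
  rw [closure_ball _ one_ne_zero]
  exact continuousOn_tsum (fun n => by fun_prop) f.summable_primitive
    fun n z hz => f.norm_primitive_term_le n (by simpa using hz)

theorem Hardy.deriv_primitive (f : Hardy F) {z : ℂ} (hz : z ∈ Metric.ball (0 : ℂ) 1) :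
    deriv f.primitive z = f.eval z := by
  have h := hasSum_deriv_of_summable_norm f.summable_primitive
    (fun n => ((differentiable_id.pow (n + 1)).smul_const _).differentiableOn)
    Metric.isOpen_ball (fun n _ hw => f.norm_primitive_term_le n (mem_ball_zero_iff.1 hw).le) hz
  refine h.unique ?_
  convert! f.hasSum_eval hz using 2 with n
  have h1 := ((hasDerivAt_pow (n + 1) z).smul_const ((n + 1 : ℂ)⁻¹ • f n)).deriv
  change deriv (fun y : ℂ => y ^ (n + 1) • ((n + 1 : ℂ)⁻¹ • f n)) z = _
  rw [h1, smul_smul]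
  congr 1
  have : (n : ℂ) + 1 ≠ 0 := by exact_mod_cast Nat.succ_ne_zero n
  push_cast
  field_simp

/-- The restriction of Lebesgue measure to one period. -/
abbrev periodMeasure : Measure ℝ := volume.restrict (Set.Ioc 0 (2 * Real.pi))

/-- The function `t ↦ (2π)^(-1/2) i e^(i(n+1)t) x`. -/
def circleMonomial (n : ℕ) (x : F) (t : ℝ) : F :=
  (((√(2 * Real.pi))⁻¹ : ℝ) * I * exp ((t : ℂ) * I) ^ (n + 1)) • x

theorem continuous_circleMonomial (n : ℕ) (x : F) : Continuous (circleMonomial n x) := by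
  unfold circleMonomial
  fun_prop

theorem memLp_circleMonomial (n : ℕ) (x : F) : MemLp (circleMonomial n x) 2 periodMeasure := by
  refine MemLp.of_bound (continuous_circleMonomial n x).aestronglyMeasurable
    (‖(((√(2 * Real.pi))⁻¹ : ℝ) : ℂ) * I‖ * ‖x‖) (ae_of_all _ fun t => ?_)
  rw [circleMonomial, norm_smul, norm_mul _ (_ ^ _), norm_pow, norm_exp_ofReal_mul_I, one_pow,
    mul_one]

variable (F) in
/-- The map `x ↦ circleMonomial n x` into the space of square integrable functions. -/
def circleMonomialₗ (n : ℕ) : F →ₗ[ℂ] Lp F 2 periodMeasure where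
  toFun x := (memLp_circleMonomial n x).toLp
  map_add' x y := by
    rw [← MemLp.toLp_add]
    congr 1
    ext t
    exact smul_add _ _ _
  map_smul' a x := by
    rw [RingHom.id_apply, ← MemLp.toLp_const_smul]
    congr 1
    ext t
    exact smul_comm _ _ _

theorem circleMonomialₗ_apply (n : ℕ) (x : F) :
    circleMonomialₗ F n x = (memLp_circleMonomial n x).toLp := rfl

/-- The factor `i` and the exponent `n + 1` come from differentiating `e^{i(n+1)t} / (n+1)`, a term
of the primitive on the circle; `(2π)^(-1/2)` is the normalization that makes `x ↦ circleMonomial n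
x` isometric. -/
theorem inner_circleMonomial (n m : ℕ) (x y : F) :
    inner ℂ (circleMonomialₗ F n x) (circleMonomialₗ F m y) =
      if m = n then inner ℂ x y else 0 := by
  have hpi : (0 : ℝ) < 2 * Real.pi := Real.two_pi_pos
  rw [L2.inner_def]
  have h1 : ∀ᵐ t ∂periodMeasure, inner ℂ (circleMonomialₗ F n x t) (circleMonomialₗ F m y t) =
      (2 * Real.pi : ℂ)⁻¹ * inner ℂ x y *
        (exp (-((t : ℂ) * I)) ^ (n + 1) * exp ((t : ℂ) * I) ^ (m + 1)) := by
    filter_upwards [(memLp_circleMonomial n x).coeFn_toLp, (memLp_circleMonomial m y).coeFn_toLp]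
      with t h1 h2
    rw [circleMonomialₗ_apply, circleMonomialₗ_apply, h1, h2, circleMonomial, circleMonomial,
      inner_smul_left, inner_smul_right]
    have h3 : conj (exp ((t : ℂ) * I)) = exp (-((t : ℂ) * I)) := by
      rw [← exp_conj, map_mul, conj_ofReal, conj_I, mul_neg]
    have h4 : (((√(2 * Real.pi))⁻¹ : ℝ) : ℂ) * (((√(2 * Real.pi))⁻¹ : ℝ) : ℂ) =
        (2 * Real.pi : ℂ)⁻¹ := by
      rw [← ofReal_mul, ← mul_inv, Real.mul_self_sqrt hpi.le]
      push_cast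
      rfl
    rw [map_mul, map_mul, map_pow, h3, conj_ofReal, conj_I, ← h4]
    linear_combination (-(((√(2 * Real.pi))⁻¹ : ℝ) : ℂ) * (((√(2 * Real.pi))⁻¹ : ℝ) : ℂ) *
      exp (-((t : ℂ) * I)) ^ (n + 1) * exp ((t : ℂ) * I) ^ (m + 1) * inner ℂ x y) * I_sq
  rw [integral_congr_ae h1, integral_const_mul, ← intervalIntegral.integral_of_le hpi.le,
    integral_expI_pow]
  simp only [add_left_inj]
  split_ifs with h
  · have : (2 * Real.pi : ℂ) ≠ 0 := by exact_mod_cast hpi.ne'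
    field_simp
  · rw [mul_zero]

variable (F) in
theorem orthogonalFamily_circleMonomial :
    OrthogonalFamily ℂ (fun _ : ℕ => F) fun n => (circleMonomialₗ F n).isometryOfInner
      fun x y => by rw [inner_circleMonomial, if_pos rfl] := by
  intro i j hij x y
  exact (inner_circleMonomial i j x y).trans (if_neg hij.symm)

theorem setIntegral_circleMonomial (n : ℕ) (x : F) {t : ℝ} (ht : t ∈ Set.Icc 0 (2 * Real.pi)) :
    ∫ s in Set.Ioc 0 t, circleMonomialₗ F n x s ∂periodMeasure =
      (((√(2 * Real.pi))⁻¹ : ℝ) : ℂ) •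
        ((exp ((t : ℂ) * I) ^ (n + 1) - 1) • ((n + 1 : ℂ)⁻¹ • x)) := by
  have h1 : ∀ᵐ s ∂(periodMeasure.restrict (Set.Ioc 0 t)),
      circleMonomialₗ F n x s = circleMonomial n x s :=
    ae_restrict_of_ae (memLp_circleMonomial n x).coeFn_toLp
  have hn : (n : ℂ) + 1 ≠ 0 := by exact_mod_cast Nat.succ_ne_zero n
  rw [integral_congr_ae h1, Measure.restrict_restrict measurableSet_Ioc,
    Set.inter_eq_left.2 (Set.Ioc_subset_Ioc_right ht.2), ← intervalIntegral.integral_of_le ht.1]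
  simp only [circleMonomial]
  rw [intervalIntegral.integral_smul_const, intervalIntegral.integral_const_mul]
  have h2 : ∀ s : ℝ, exp ((s : ℂ) * I) ^ (n + 1) = exp (((n + 1 : ℂ) * I) * s) := by
    intro s
    rw [← exp_nat_mul]
    congr 1
    push_cast
    ring
  simp_rw [h2]
  rw [integral_exp_mul_complex (mul_ne_zero hn I_ne_zero), smul_smul, smul_smul]
  congr 1
  simp only [ofReal_zero, mul_zero, exp_zero]
  field_simp [I_ne_zero]

/-- The primitive is absolutely continuous on the circle, with square integrable derivative. -/
theorem Hardy.primitive_sub_primitive (f : Hardy F) {t : ℝ} (ht : t ∈ Set.Icc 0 (2 * Real.pi)) :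
    (((√(2 * Real.pi))⁻¹ : ℝ) : ℂ) • (f.primitive (exp ((t : ℂ) * I)) - f.primitive 1) =
      ∫ s in (0 : ℝ)..t, (orthogonalFamily_circleMonomial F).linearIsometry f s := by
  set φ := (orthogonalFamily_circleMonomial F).linearIsometry f with hφ
  have h0 : ∫ s in (0 : ℝ)..t, φ s = ∫ s in Set.Ioc 0 t, φ s ∂periodMeasure := by
    rw [Measure.restrict_restrict measurableSet_Ioc,
      Set.inter_eq_left.2 (Set.Ioc_subset_Ioc_right ht.2), intervalIntegral.integral_of_le ht.1]
  rw [h0]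
  -- Paired with `y`, the integral over `(0, t]` becomes an L² inner product with an indicator
  -- function, so the L²-convergent series of `φ` may be integrated term by term.
  refine ext_inner_left ℂ fun y => ?_
  have hμ : periodMeasure (Set.Ioc 0 t) ≠ ⊤ := measure_ne_top _ _
  rw [← L2.inner_indicatorConstLp_eq_inner_setIntegral ℂ measurableSet_Ioc hμ y φ]
  have h1 := ((orthogonalFamily_circleMonomial F).hasSum_linearIsometry f).mapL
    (innerSL ℂ (indicatorConstLp 2 measurableSet_Ioc hμ y))
  refine HasSum.unique ?_ h1
  have h2 := ((((f.hasSum_primitive (norm_exp_ofReal_mul_I t).le).sub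
    (f.hasSum_primitive (z := 1) (by simp))).const_smul
      (((√(2 * Real.pi))⁻¹ : ℝ) : ℂ))).mapL (innerSL ℂ y)
  convert! h2 using 2 with n
  change inner ℂ _ (circleMonomialₗ F n (f n)) = inner ℂ y _
  rw [L2.inner_indicatorConstLp_eq_inner_setIntegral ℂ measurableSet_Ioc hμ y,
    setIntegral_circleMonomial n _ ht, one_pow, ← sub_smul]

/-- **Fatou's theorem**: elements of the Hardy space have radial limits almost everywhere. -/
theorem Hardy.ae_exists_radial_limit (f : Hardy F) :
    ∀ᵐ t : ℝ, ∃ v : F, Tendsto (fun r : ℝ => f.eval ((r : ℂ) * exp ((t : ℂ) * I))) (𝓝[<] 1)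
      (𝓝 v) := by
  refine ae_circle_of_ae_restrict
    (P := fun ζ => ∃ v : F, Tendsto (fun r : ℝ => f.eval ((r : ℂ) * ζ)) (𝓝[<] 1) (𝓝 v)) ?_
  set φ := (orthogonalFamily_circleMonomial F).linearIsometry f with hφ
  set k : ℂ := (((√(2 * Real.pi))⁻¹ : ℝ) : ℂ) with hk
  have hpi : (0 : ℝ) < 2 * Real.pi := Real.two_pi_pos
  have hk0 : k ≠ 0 := by
    rw [hk, ofReal_ne_zero]
    positivity
  have hint : IntervalIntegrable φ volume 0 (2 * Real.pi) := by
    rw [intervalIntegrable_iff_integrableOn_Ioc_of_le hpi.le]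
    exact (Lp.memLp φ).integrable one_le_two
  have hne : ∀ᵐ t : ℝ, t ≠ 2 * Real.pi := by simp [ae_iff, measure_singleton]
  -- The endpoint `2π` is discarded because the integral formula for the primitive must hold on a
  -- neighbourhood of `t`.
  filter_upwards [hint.ae_hasDerivAt_integral, hne] with t ht hne ht'
  have h1 := ht (by rw [Set.uIcc_of_le hpi.le]; exact Set.Ioc_subset_Icc_self ht') 0 (by simp)
  have h2 : HasDerivAt (fun s : ℝ => f.primitive (exp ((s : ℂ) * I))) (k⁻¹ • φ t) t := by
    have h3 := (h1.const_smul k⁻¹).add_const (f.primitive 1)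
    refine h3.congr_of_eventuallyEq ?_
    filter_upwards [Ioo_mem_nhds ht'.1 (lt_of_le_of_ne ht'.2 hne)] with s hs
    have h4 := f.primitive_sub_primitive (Set.Ioo_subset_Icc_self hs)
    change _ = k⁻¹ • (∫ s in (0 : ℝ)..s, φ s) + f.primitive 1
    rw [← h4, inv_smul_smul₀ hk0, sub_add_cancel]
  refine ⟨_, (tendsto_deriv_radial_of_hasDerivAt f.diffContOnCl_primitive h2).congr' ?_⟩
  filter_upwards [Ioo_mem_nhdsLT (zero_lt_one' ℝ)] with r hr
  exact f.deriv_primitive (mem_ball_of_polar hr.1.le hr.2 t)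

end Fatou

/-! ### Inner functions, isometric multiplication and the Beurling–Lax–Halmos theorem. -/

section Inner

variable {E : Type u} [NormedAddCommGroup E] [InnerProductSpace ℂ E] [CompleteSpace E]
  {F : Type u} [NormedAddCommGroup F] [InnerProductSpace ℂ F] [CompleteSpace F]

/-- The mean square over radius `r` is `∑ r²ⁿ ‖g n‖²`, dominated by the series for `‖g‖²`. -/
theorem Hardy.tendsto_circle_mean (g : Hardy F) :
    Tendsto (fun r : ℝ => (2 * Real.pi)⁻¹ *
      ∫ t in (0 : ℝ)..(2 * Real.pi), ‖g.eval ((r : ℂ) * exp ((t : ℂ) * I))‖ ^ 2)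
      (𝓝[<] 1) (𝓝 (‖g‖ ^ 2)) := by
  have h1 : Tendsto (fun r : ℝ => ∑' n, (r ^ n * ‖g n‖) ^ 2) (𝓝[<] 1) (𝓝 (∑' n, ‖g n‖ ^ 2)) := by
    refine tendsto_tsum_of_dominated_convergence g.norm_sq_hasSum.summable (fun n => ?_) ?_
    · have hc : Continuous fun r : ℝ => (r ^ n * ‖g n‖) ^ 2 := by fun_prop
      simpa using (hc.tendsto 1).mono_left (nhdsWithin_le_nhds (s := Set.Iio 1))
    · filter_upwards [Ioo_mem_nhdsLT (zero_lt_one' ℝ)] with r hr n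
      rw [Real.norm_of_nonneg (sq_nonneg _)]
      have := hr.1.le
      refine pow_le_pow_left₀ (by positivity) ?_ 2
      exact mul_le_of_le_one_left (norm_nonneg _) (pow_le_one₀ hr.1.le hr.2.le)
  rw [g.norm_sq_hasSum.tsum_eq] at h1
  refine h1.congr' ?_
  filter_upwards [Ioo_mem_nhdsLT (zero_lt_one' ℝ)] with r hr
  exact (hasSum_circle (fun z hz => g.hasSum_eval hz) hr.1.le hr.2).tsum_eq

theorem Hardy.continuous_eval_circle (g : Hardy F) {r : ℝ} (h0 : 0 ≤ r) (h1 : r < 1) :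
    Continuous fun t : ℝ => g.eval ((r : ℂ) * exp ((t : ℂ) * I)) :=
  g.differentiableOn_eval.continuousOn.comp_continuous (by fun_prop) (mem_ball_of_polar h0 h1)

/-- The norm of a bounded function in the Hardy space in terms of its boundary values. -/
theorem Hardy.integral_sq_eq_norm_sq (g : Hardy F) {B : ℝ}
    (hB : ∀ z ∈ Metric.ball (0 : ℂ) 1, ‖g.eval z‖ ≤ B) {b : ℝ → ℝ}
    (hb : ∀ᵐ t : ℝ, Tendsto (fun r : ℝ => ‖g.eval ((r : ℂ) * exp ((t : ℂ) * I))‖)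
      (𝓝[<] 1) (𝓝 (b t))) :
    (2 * Real.pi)⁻¹ * ∫ t in (0 : ℝ)..(2 * Real.pi), b t ^ 2 = ‖g‖ ^ 2 := by
  refine tendsto_nhds_unique (Tendsto.const_mul _ ?_) g.tendsto_circle_mean
  refine intervalIntegral.tendsto_integral_filter_of_dominated_convergence (fun _ => B ^ 2)
    ?_ ?_ ?_ ?_
  · filter_upwards [Ioo_mem_nhdsLT (zero_lt_one' ℝ)] with r hr
    exact ((g.continuous_eval_circle hr.1.le hr.2).norm.pow 2).aestronglyMeasurable
  · filter_upwards [Ioo_mem_nhdsLT (zero_lt_one' ℝ)] with r hr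
    refine ae_of_all _ fun t _ => ?_
    rw [Real.norm_of_nonneg (sq_nonneg _)]
    exact pow_le_pow_left₀ (norm_nonneg _) (hB _ (mem_ball_of_polar hr.1.le hr.2 t)) 2
  · exact _root_.intervalIntegrable_const
  · filter_upwards [hb] with t ht _
    exact ht.pow 2

theorem eventually_polar_mem_ball (t : ℝ) :
    ∀ᶠ r : ℝ in 𝓝[<] 1, (r : ℂ) * exp ((t : ℂ) * I) ∈ Metric.ball (0 : ℂ) 1 := by
  filter_upwards [Ioo_mem_nhdsLT (zero_lt_one' ℝ)] with r hr
  exact mem_ball_of_polar hr.1.le hr.2 t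

/-- The boundary values of `Θ x`, for a contractive `Θ` for which `M_Θ` is isometric on
constants. -/
theorem ae_exists_radial_limit_norm_eq (Θ : HInfty E F)
    (hb : ∀ z ∈ Metric.ball (0 : ℂ) 1, ‖Θ z‖ ≤ 1) {x : E}
    (hx : ‖mulOp Θ (lp.single 2 0 x)‖ = ‖x‖) :
    ∀ᵐ t : ℝ, ∃ v : F, Tendsto (fun r : ℝ => Θ ((r : ℂ) * exp ((t : ℂ) * I)) x) (𝓝[<] 1)
      (𝓝 v) ∧ ‖v‖ = ‖x‖ := by
  refine ae_circle_of_ae_restrict (P := fun ζ => ∃ v : F,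
    Tendsto (fun r : ℝ => Θ ((r : ℂ) * ζ) x) (𝓝[<] 1) (𝓝 v) ∧ ‖v‖ = ‖x‖) ?_
  set g := mulOp Θ (lp.single 2 0 x) with hg
  have hgz : ∀ z ∈ Metric.ball (0 : ℂ) 1, g.eval z = Θ z x := fun z hz =>
    mulOp_single_eval Θ x hz
  have hgb : ∀ z ∈ Metric.ball (0 : ℂ) 1, ‖g.eval z‖ ≤ ‖x‖ := by
    intro z hz
    rw [hgz z hz]
    simpa using (Θ z).le_of_opNorm_le (hb z hz) x
  classical
  set v : ℝ → F := fun t => if h : ∃ v : F,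
    Tendsto (fun r : ℝ => g.eval ((r : ℂ) * exp ((t : ℂ) * I))) (𝓝[<] 1) (𝓝 v) then h.choose
    else 0 with hvdef
  have hv : ∀ᵐ t : ℝ, Tendsto (fun r : ℝ => g.eval ((r : ℂ) * exp ((t : ℂ) * I))) (𝓝[<] 1)
      (𝓝 (v t)) := by
    filter_upwards [g.ae_exists_radial_limit] with t ht
    rw [hvdef]
    simp only [dif_pos ht]
    exact ht.choose_spec
  have hvle : ∀ᵐ t : ℝ, ‖v t‖ ≤ ‖x‖ := by
    filter_upwards [hv] with t ht
    exact le_of_tendsto ht.norm ((eventually_polar_mem_ball t).mono fun r hr => hgb _ hr)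
  have hpi : (0 : ℝ) < 2 * Real.pi := Real.two_pi_pos
  have hmean := g.integral_sq_eq_norm_sq hgb (hv.mono fun t ht => ht.norm)
  rw [hx, inv_mul_eq_iff_eq_mul₀ hpi.ne'] at hmean
  have hmeas : AEStronglyMeasurable (fun t => ‖v t‖ ^ 2) periodMeasure := by
    -- The pointwise choice of `v` is not visibly measurable, but it is almost everywhere a limit of
    -- continuous functions along a sequence of radii.
    have h1 : AEStronglyMeasurable v periodMeasure := by
      obtain ⟨ρ, -, hρ, hlim⟩ := exists_seq_strictMono_tendsto' (zero_lt_one' ℝ)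
      have hlim' : Tendsto ρ atTop (𝓝[<] 1) :=
        tendsto_nhdsWithin_iff.2 ⟨hlim, Eventually.of_forall fun n => (hρ n).2⟩
      refine aestronglyMeasurable_of_tendsto_ae atTop
        (f := fun n (t : ℝ) => g.eval ((ρ n : ℂ) * exp ((t : ℂ) * I))) (fun n =>
          (g.continuous_eval_circle (hρ n).1.le (hρ n).2).aestronglyMeasurable) ?_
      exact ae_restrict_of_ae (hv.mono fun t ht => ht.comp hlim')
    exact h1.norm.pow 2
  have hint : Integrable (fun t => ‖v t‖ ^ 2) periodMeasure := by
    refine Integrable.of_bound hmeas (‖x‖ ^ 2) (ae_restrict_of_ae ?_)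
    filter_upwards [hvle] with t ht
    rw [Real.norm_of_nonneg (sq_nonneg _)]
    exact pow_le_pow_left₀ (norm_nonneg _) ht 2
  -- The integrand is nonnegative almost everywhere by contractivity, and the mean of `‖v‖²` is
  -- `‖M_Θ x‖² = ‖x‖²`; hence equality holds almost everywhere.
  have hzero : ∫ t, (‖x‖ ^ 2 - ‖v t‖ ^ 2) ∂periodMeasure = 0 := by
    rw [integral_sub (integrable_const _) hint, ← intervalIntegral.integral_of_le hpi.le,
      ← intervalIntegral.integral_of_le hpi.le, hmean, intervalIntegral.integral_const]
    simp
  have hae := (integral_eq_zero_iff_of_nonneg_ae (ae_restrict_of_ae (by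
    filter_upwards [hvle] with t ht
    exact sub_nonneg.2 (pow_le_pow_left₀ (norm_nonneg _) ht 2)))
    ((integrable_const _).sub hint)).1 hzero
  have hae' := (ae_restrict_iff' measurableSet_Ioc).1 hae
  filter_upwards [hae', hv] with t h1 h2 h3
  refine ⟨v t, h2.congr' ((eventually_polar_mem_ball t).mono fun r hr => hgz _ hr), ?_⟩
  have h4 : ‖x‖ ^ 2 - ‖v t‖ ^ 2 = 0 := h1 h3
  exact (pow_left_inj₀ (norm_nonneg _) (norm_nonneg _) two_ne_zero).1 (sub_eq_zero.1 h4).symm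

/-- A bounded family of operators that converges isometrically on a dense set converges strongly
to an isometry. -/
theorem exists_isometry_of_dense {ι : Type*} {l : Filter ι} [l.NeBot] {A : ι → E →L[ℂ] F}
    (hA : ∀ᶠ i in l, ‖A i‖ ≤ 1) {D : Set E} (hD : Dense D)
    (h : ∀ x ∈ D, ∃ v, Tendsto (fun i => A i x) l (𝓝 v) ∧ ‖v‖ = ‖x‖) :
    ∃ V : E →ₗᵢ[ℂ] F, ∀ x, Tendsto (fun i => A i x) l (𝓝 (V x)) := by
  have hle : ∀ᶠ i in l, ∀ x, ‖A i x‖ ≤ ‖x‖ := hA.mono fun i hi x => by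
    simpa using (A i).le_of_opNorm_le hi x
  have hex : ∀ x, ∃ v, Tendsto (fun i => A i x) l (𝓝 v) := by
    intro x
    rw [← cauchy_map_iff_exists_tendsto, Metric.cauchy_iff]
    refine ⟨inferInstance, fun ε hε => ?_⟩
    obtain ⟨y, hy, hxy⟩ := Metric.dense_iff.1 hD x (ε / 4) (by positivity)
    rw [Metric.mem_ball, dist_eq_norm] at hy
    obtain ⟨v, hv, -⟩ := h y hxy
    refine ⟨Metric.ball v (ε / 2), ?_, fun a ha b hb => ?_⟩
    · change ∀ᶠ i in l, A i x ∈ Metric.ball v (ε / 2)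
      filter_upwards [hle, hv.eventually (Metric.ball_mem_nhds v (show 0 < ε / 4 by positivity))]
        with i hi h1
      have h2 : ‖A i x - A i y‖ < ε / 4 := by
        rw [← map_sub, ← norm_neg, ← map_neg, neg_sub]
        exact (hi _).trans_lt hy
      rw [Metric.mem_ball]
      calc dist (A i x) v ≤ dist (A i x) (A i y) + dist (A i y) v := dist_triangle _ _ _
        _ < ε / 2 := by rw [dist_eq_norm (A i x)]; linarith
    · calc dist a b ≤ dist a v + dist b v := dist_triangle_right _ _ _
        _ < ε := by
          rw [Metric.mem_ball] at ha hb
          linarith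
  choose V hV using hex
  have hVn : ∀ x, ‖V x‖ ≤ ‖x‖ := fun x =>
    le_of_tendsto (hV x).norm (hle.mono fun i hi => hi x)
  let L : E →ₗ[ℂ] F :=
    { toFun := V
      map_add' := fun x y => tendsto_nhds_unique (hV (x + y)) (by
        simpa only [map_add] using (hV x).add (hV y))
      map_smul' := fun a x => tendsto_nhds_unique (hV (a • x)) (by
        simpa only [map_smul, RingHom.id_apply] using (hV x).const_smul a) }
  have hc : Continuous V := (L.mkContinuous 1 fun x => by
    rw [one_mul]; exact hVn x).continuous
  refine ⟨⟨L, fun x => ?_⟩, hV⟩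
  refine hD.induction (P := fun x => ‖V x‖ = ‖x‖) (fun y hy => ?_)
    (isClosed_eq hc.norm continuous_norm) x
  obtain ⟨v, hv, hvn⟩ := h y hy
  rw [tendsto_nhds_unique (hV y) hv, hvn]

/-- The exceptional null set for the radial limit of `Θ x` depends on `x`. A countable dense set of
vectors has a common one, and the uniform bound extends convergence and isometry to all of `E`. -/
theorem isInner_of_isometry [TopologicalSpace.SeparableSpace E] (Θ : HInfty E F)
    (hb : ∀ z ∈ Metric.ball (0 : ℂ) 1, ‖Θ z‖ ≤ 1) (hiso : ∀ f, ‖mulOp Θ f‖ = ‖f‖) :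
    Θ.IsInner := by
  obtain ⟨D, hDc, hD⟩ := TopologicalSpace.exists_countable_dense E
  have h1 := (ae_ball_iff hDc).2 fun x _ => ae_exists_radial_limit_norm_eq Θ hb (x := x)
    (by rw [hiso, lp.norm_single (by norm_num)])
  filter_upwards [h1] with t ht
  exact exists_isometry_of_dense ((eventually_polar_mem_ball t).mono fun r hr => hb _ hr) hD ht

/-- A polynomial `p` and `Θ p` are bounded and have boundary values of equal norm almost everywhere,
so their mean squares agree. Polynomials are dense, and both norms are continuous. -/
theorem norm_mulOp_of_isInner {Θ : HInfty E F} (hΘ : Θ.IsInner) (f : Hardy E) :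
    ‖mulOp Θ f‖ = ‖f‖ := by
  obtain ⟨C, hC⟩ := Θ.bounded
  have hC0 : 0 ≤ C := (norm_nonneg _).trans (hC 0 (by simp))
  have key : ∀ (s : Finset ℕ) (a : ℕ → E),
      ‖mulOp Θ (∑ n ∈ s, lp.single 2 n (a n))‖ = ‖(∑ n ∈ s, lp.single 2 n (a n) : Hardy E)‖ := by
    intro s a
    set p : Hardy E := ∑ n ∈ s, lp.single 2 n (a n) with hp
    have hpe : ∀ z ∈ Metric.ball (0 : ℂ) 1, p.eval z = ∑ n ∈ s, z ^ n • a n := by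
      intro z hz
      rw [← Hardy.evalL_apply z hz, hp, map_sum]
      exact Finset.sum_congr rfl fun n _ => Hardy.eval_single n (a n) z
    have hpb : ∀ z ∈ Metric.ball (0 : ℂ) 1, ‖p.eval z‖ ≤ ∑ n ∈ s, ‖a n‖ := by
      intro z hz
      rw [hpe z hz]
      refine norm_sum_le_of_le _ fun n _ => ?_
      rw [norm_smul, norm_pow]
      exact mul_le_of_le_one_left (norm_nonneg _)
        (pow_le_one₀ (norm_nonneg _) (mem_ball_zero_iff.1 hz).le)
    have hgb : ∀ z ∈ Metric.ball (0 : ℂ) 1, ‖(mulOp Θ p).eval z‖ ≤ C * ∑ n ∈ s, ‖a n‖ := by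
      intro z hz
      rw [eval_mulOp Θ p hz]
      exact ((Θ z).le_of_opNorm_le (hC z hz) _).trans (by gcongr; exact hpb z hz)
    set b : ℝ → ℝ := fun t => ‖∑ n ∈ s, exp ((t : ℂ) * I) ^ n • a n‖ with hbdef
    have hpow : ∀ (t : ℝ) (n : ℕ), Tendsto (fun r : ℝ => ((r : ℂ) * exp ((t : ℂ) * I)) ^ n)
        (𝓝[<] 1) (𝓝 (exp ((t : ℂ) * I) ^ n)) := by
      intro t n
      have hc : Continuous fun r : ℝ => ((r : ℂ) * exp ((t : ℂ) * I)) ^ n := by fun_prop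
      simpa using (hc.tendsto 1).mono_left (nhdsWithin_le_nhds (s := Set.Iio 1))
    have h1 : ∀ᵐ t : ℝ, Tendsto (fun r : ℝ => ‖p.eval ((r : ℂ) * exp ((t : ℂ) * I))‖)
        (𝓝[<] 1) (𝓝 (b t)) := by
      refine ae_of_all _ fun t => ?_
      refine (tendsto_finsetSum s fun n _ => (hpow t n).smul_const (a n)).norm.congr' ?_
      filter_upwards [eventually_polar_mem_ball t] with r hr
      rw [hpe _ hr]
    have h2 : ∀ᵐ t : ℝ, Tendsto
        (fun r : ℝ => ‖(mulOp Θ p).eval ((r : ℂ) * exp ((t : ℂ) * I))‖) (𝓝[<] 1) (𝓝 (b t)) := by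
      filter_upwards [hΘ] with t ht
      obtain ⟨V, hV⟩ := ht
      have h3 := (tendsto_finsetSum s fun n _ => (hpow t n).smul (hV (a n))).norm
      have h4 : ‖∑ n ∈ s, exp ((t : ℂ) * I) ^ n • V (a n)‖ = b t := by
        simp only [hbdef, ← map_smul, ← map_sum, V.norm_map]
      rw [h4] at h3
      refine h3.congr' ?_
      filter_upwards [eventually_polar_mem_ball t] with r hr
      rw [eval_mulOp Θ p hr, hpe _ hr, map_sum]
      simp only [map_smul]
    have h5 := (Hardy.integral_sq_eq_norm_sq _ hgb h2).symm.trans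
      (Hardy.integral_sq_eq_norm_sq _ hpb h1)
    exact (pow_left_inj₀ (norm_nonneg _) (norm_nonneg _) two_ne_zero).1 h5
  have hf : HasSum (fun n => lp.single 2 n (f n)) f := lp.hasSum_single (by simp) f
  have h6 : Tendsto (fun s : Finset ℕ => ‖mulOp Θ (∑ n ∈ s, lp.single 2 n (f n))‖) atTop
      (𝓝 ‖mulOp Θ f‖) := (((mulOp Θ).continuous.norm).tendsto f).comp hf
  exact tendsto_nhds_unique h6 ((Tendsto.norm hf).congr fun s => (key s f).symm)

/-- The **Beurling–Lax–Halmos theorem**. -/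
theorem exists_inner_range_eq [TopologicalSpace.SeparableSpace F] {M : Submodule ℂ (Hardy F)}
    (hM : IsClosed (M : Set (Hardy F))) (hS : ∀ f ∈ M, shift F f ∈ M) :
    ∃ (E : Type u) (_ : NormedAddCommGroup E) (_ : InnerProductSpace ℂ E)
      (_ : CompleteSpace E) (_ : TopologicalSpace.SeparableSpace E) (Θ : HInfty E F),
      Θ.IsInner ∧ M = (mulOp Θ).toLinearMap.range := by
  have : CompleteSpace (wandering M) := (isClosed_wandering hM).completeSpace_coe
  obtain ⟨T, hT, hr⟩ := exists_isometry_range_eq hM hS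
  obtain ⟨Θ, hΘ, hb⟩ := exists_mulOp_eq T.toContinuousLinearMap hT
  have hsep : TopologicalSpace.SeparableSpace (wandering M) :=
    (TopologicalSpace.IsSeparable.of_separableSpace (wandering M : Set (Hardy F))).separableSpace
  refine ⟨wandering M, inferInstance, inferInstance, this, hsep, Θ, ?_, ?_⟩
  · refine isInner_of_isometry Θ (fun z hz => (hb z hz).trans T.norm_toContinuousLinearMap_le)
      fun f => ?_
    rw [hΘ]
    exact T.norm_map f
  · rw [hΘ]
    exact hr.symm

end Inner

/-! ### Transporting the tuple through an inner function. -/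

section Symbols

variable {E : Type u} [NormedAddCommGroup E] [InnerProductSpace ℂ E] [CompleteSpace E]
  {F : Type u} [NormedAddCommGroup F] [InnerProductSpace ℂ F] [CompleteSpace F]

theorem mulTuple_castSucc {m : ℕ} (Φ : Fin m → HInfty E E) (i : Fin m) :
    mulTuple Φ i.castSucc = mulOp (Φ i) := by
  simp only [mulTuple, Fin.snoc_castSucc]

theorem mulTuple_last {m : ℕ} (Φ : Fin m → HInfty E E) :
    mulTuple Φ (Fin.last m) = shift E := by
  simp only [mulTuple, Fin.snoc_last]

theorem mulOp_mulTuple {m : ℕ} {Φ : Fin m → HInfty F F} {Ψ : Fin m → HInfty E E}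
    {Θ : HInfty E F}
    (h : ∀ i f, mulOp Θ (mulOp (Ψ i) f) = mulOp (Φ i) (mulOp Θ f)) (j : Fin (m + 1))
    (f : Hardy E) : mulOp Θ (mulTuple Ψ j f) = mulTuple Φ j (mulOp Θ f) := by
  induction j using Fin.lastCases with
  | last => rw [mulTuple_last, mulTuple_last, shift_comm_mulOp]
  | cast i => rw [mulTuple_castSucc, mulTuple_castSucc, h]

theorem mulOp_comm_of_comp_eq {Φ : HInfty F F} {Ψ : HInfty E E} {Θ : HInfty E F}
    (h : ∀ z ∈ Metric.ball (0 : ℂ) 1, (Φ z).comp (Θ z) = (Θ z).comp (Ψ z)) (f : Hardy E) :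
    mulOp Θ (mulOp Ψ f) = mulOp Φ (mulOp Θ f) := by
  refine Hardy.ext_eval fun z hz => ?_
  rw [eval_mulOp _ _ hz, eval_mulOp _ _ hz, eval_mulOp _ _ hz, eval_mulOp _ _ hz]
  exact (congrArg (fun L => L (f.eval z)) (h z hz)).symm

theorem comp_eq_of_mulOp_comm {Φ : HInfty F F} {Ψ : HInfty E E} {Θ : HInfty E F}
    (h : ∀ f, mulOp Θ (mulOp Ψ f) = mulOp Φ (mulOp Θ f)) {z : ℂ}
    (hz : z ∈ Metric.ball (0 : ℂ) 1) : (Φ z).comp (Θ z) = (Θ z).comp (Ψ z) := by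
  ext x
  have h1 := congrArg (fun g : Hardy F => g.eval z) (h (lp.single 2 0 x))
  simp only [eval_mulOp _ _ hz, Hardy.eval_single, pow_zero, one_smul] at h1
  exact h1.symm

theorem isJointlyInvariant_range {m : ℕ} {Φ : Fin m → HInfty F F} {Ψ : Fin m → HInfty E E}
    {Θ : HInfty E F}
    (h : ∀ i, ∀ z ∈ Metric.ball (0 : ℂ) 1, (Φ i z).comp (Θ z) = (Θ z).comp (Ψ i z)) :
    IsJointlyInvariant Φ (mulOp Θ).toLinearMap.range := by
  rintro j _ ⟨f, rfl⟩
  exact ⟨mulTuple Ψ j f, mulOp_mulTuple (fun i => mulOp_comm_of_comp_eq (h i)) j f⟩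

/-- An operator that leaves the range of an isometric multiplication operator invariant and
commutes with the shift induces a multiplication operator. -/
theorem exists_mulOp_comm {Θ : HInfty E F} (hΘ : ∀ f, ‖mulOp Θ f‖ = ‖f‖) {Φ : HInfty F F}
    (hinv : ∀ f ∈ (mulOp Θ).toLinearMap.range, mulOp Φ f ∈ (mulOp Θ).toLinearMap.range) :
    ∃ Ψ : HInfty E E, ∀ f, mulOp Θ (mulOp Ψ f) = mulOp Φ (mulOp Θ f) := by
  set W := mulOp Θ with hW
  have hinj : Function.Injective W :=
    (AddMonoidHomClass.isometry_of_norm W hΘ).injective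
  have hadj := (ContinuousLinearMap.norm_map_iff_adjoint_comp_self W).1 hΘ
  -- Since `W* W = 1` and `M_Φ W f` is in the range of `W`, this satisfies `W T = M_Φ W`;
  -- commutation with the shift can then be checked after applying the injective `W`.
  set T := (ContinuousLinearMap.adjoint W).comp ((mulOp Φ).comp W) with hT
  have hWT : ∀ f, W (T f) = mulOp Φ (W f) := by
    intro f
    obtain ⟨g, hg⟩ := hinv (W f) ⟨f, rfl⟩
    have hg' : W g = mulOp Φ (W f) := hg
    have h1 : ContinuousLinearMap.adjoint W (W g) = g := congrArg (fun L => L g) hadj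
    change W (ContinuousLinearMap.adjoint W (mulOp Φ (W f))) = _
    rw [← hg', h1]
  obtain ⟨Ψ, hΨ, -⟩ := exists_mulOp_eq T fun f => hinj (by
    rw [hWT, hW, shift_comm_mulOp, shift_comm_mulOp, shift_comm_mulOp, ← hW, hWT])
  exact ⟨Ψ, fun f => by rw [hΨ, hWT]⟩

/-- Through the isometry `M_Θ` the Ψ-tuple is a copy of the restriction of the Φ-tuple to an
invariant subspace. Commutation follows by injectivity of `M_Θ`, and the same Γ_n-unitary serves as
an extension. -/
theorem exists_isPureGammaIsometry {m : ℕ} {Φ : Fin m → HInfty F F}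
    (hΦ : IsPureGammaIsometry (mulTuple Φ)) {Θ : HInfty E F} (hΘ : Θ.IsInner)
    (hinv : IsJointlyInvariant Φ (mulOp Θ).toLinearMap.range) :
    ∃ Ψ : Fin m → HInfty E E, IsPureGammaIsometry (mulTuple Ψ) ∧
      ∀ i, ∀ z ∈ Metric.ball (0 : ℂ) 1, (Φ i z).comp (Θ z) = (Θ z).comp (Ψ i z) := by
  have hiso := norm_mulOp_of_isInner hΘ
  have hinj : Function.Injective (mulOp Θ) :=
    (AddMonoidHomClass.isometry_of_norm (mulOp Θ) hiso).injective
  choose Ψ hΨ using fun i => exists_mulOp_comm hiso (Φ := Φ i) fun f hf => by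
    simpa only [mulTuple_castSucc] using hinv i.castSucc f hf
  have hΨΦ := mulOp_mulTuple hΨ
  refine ⟨Ψ, ⟨⟨fun i j => ?_, ?_⟩, ?_⟩, fun i z hz => comp_eq_of_mulOp_comm (hΨ i) hz⟩
  · ext1 f
    refine hinj ?_
    rw [mul_apply_eq_comp, mul_apply_eq_comp, hΨΦ, hΨΦ, hΨΦ, hΨΦ, ← mul_apply_eq_comp,
      ← mul_apply_eq_comp, (hΦ.1.1 i j).eq]
  · obtain ⟨K, i1, i2, i3, J, T, hT, hJ⟩ := hΦ.1.2
    refine ⟨K, i1, i2, i3, J.comp ⟨(mulOp Θ).toLinearMap, hiso⟩, T, hT, fun i f => ?_⟩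
    change T i (J (mulOp Θ f)) = J (mulOp Θ (mulTuple Ψ i f))
    rw [hJ, hΨΦ]
  · rw [mulTuple_last]
    exact isPureIsometry_shift

end Symbols

end GammaN

/-- `F` is the space `𝓔_*`, `n = m + 1`, and `(M_Φ, M_z)` is a pure `Γ_n`-isometry on `H²(F)`.
The first part says that `M` is jointly invariant iff it has a Beurling-Lax-Halmos representation
`M = Θ H²(E)` together with the required `Ψ`; the second part is the same equivalence for every
given Beurling-Lax-Halmos representation of `M`. -/
theorem mainTheorem5 {F : Type u} [NormedAddCommGroup F] [InnerProductSpace ℂ F]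
    [CompleteSpace F] [TopologicalSpace.SeparableSpace F] (m : ℕ)
    (Φ : Fin m → GammaN.HInfty F F)
    (hΦ : GammaN.IsPureGammaIsometry (GammaN.mulTuple Φ))
    (M : Submodule ℂ (GammaN.Hardy F)) (hMclosed : IsClosed (M : Set (GammaN.Hardy F)))
    (hM : M ≠ ⊥) :
    (GammaN.IsJointlyInvariant Φ M ↔
      ∃ (E : Type u) (_ : NormedAddCommGroup E) (_ : InnerProductSpace ℂ E)
        (_ : CompleteSpace E) (_ : TopologicalSpace.SeparableSpace E) (Θ : GammaN.HInfty E F),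
        Θ.IsInner ∧ M = (GammaN.mulOp Θ).toLinearMap.range ∧
          ∃ Ψ : Fin m → GammaN.HInfty E E,
            GammaN.IsPureGammaIsometry (GammaN.mulTuple Ψ) ∧
            ∀ i, ∀ z ∈ Metric.ball (0 : ℂ) 1, (Φ i z).comp (Θ z) = (Θ z).comp (Ψ i z)) ∧
    (∀ (E : Type u) [NormedAddCommGroup E] [InnerProductSpace ℂ E] [CompleteSpace E]
        [TopologicalSpace.SeparableSpace E] (Θ : GammaN.HInfty E F),
        Θ.IsInner → M = (GammaN.mulOp Θ).toLinearMap.range →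
          (GammaN.IsJointlyInvariant Φ M ↔
            ∃ Ψ : Fin m → GammaN.HInfty E E,
              GammaN.IsPureGammaIsometry (GammaN.mulTuple Ψ) ∧
              ∀ i, ∀ z ∈ Metric.ball (0 : ℂ) 1, (Φ i z).comp (Θ z) = (Θ z).comp (Ψ i z))) := by
  have hshift : GammaN.IsJointlyInvariant Φ M → ∀ f ∈ M, GammaN.shift F f ∈ M := fun h f hf => by
    simpa only [GammaN.mulTuple_last] using h (Fin.last m) f hf
  refine ⟨⟨fun h => ?_, ?_⟩, fun E _ _ _ _ Θ hΘ hr => ⟨fun h => ?_, ?_⟩⟩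
  · obtain ⟨E, i1, i2, i3, i4, Θ, hΘ, rfl⟩ := GammaN.exists_inner_range_eq hMclosed (hshift h)
    exact ⟨E, i1, i2, i3, i4, Θ, hΘ, rfl, GammaN.exists_isPureGammaIsometry hΦ hΘ h⟩
  · rintro ⟨E, i1, i2, i3, i4, Θ, -, rfl, Ψ, -, h⟩
    exact GammaN.isJointlyInvariant_range h
  · subst hr
    exact GammaN.exists_isPureGammaIsometry hΦ hΘ h
  · rintro ⟨Ψ, -, h⟩
    subst hr
    exact GammaN.isJointlyInvariant_range h
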